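/- **Setting.** Let $M_A,M_B>0$ and $c_A,c_B\in(0,1)$. For $p\in\mathbb R$ and $R_A,R_B\ge 0$, consider the constant-sum General Lotto game with favoritism on a single battlefield of unit value: player $i\in\{A,B\}$ chooses a probability distribution $F_i$ on $[0,\infty)$ with mean at most $R_i$, player $A$'s payoff is $\Pr[x_A+p\ge x_B]$ with $x_A\sim F_A$, $x_B\sim F_B$ independent, and $B$'s payoff is one minus that. Let $\pi_A^*(p,R_A,R_B)=\sup_{F_A}\inf_{F_B}\Pr[x_A+p\ge x_B]$, which is $A$'s payoff in every Nash equilibrium. In the Stackelberg game, $A$ first chooses a pre-allocation $p_A\in[0,M_A/c_A]$, then $B$, having observed it, chooses $p_B\in[0,M_B/c_B]$, and the payoffs are $$u_A(p_A,p_B)=\pi_A^*(p_A-p_B,\;M_A-c_Ap_A,\;M_B-c_Bp_B),\qquad u_B=1-u_A .$$ A pair $(p_A^*,p_B^*)$ is a *Stackelberg equilibrium* if $p_A^*$ maximizes $\inf_{p_B\in[0,M_B/c_B]}u_A(p_A,p_B)$ over $p_A\in[0,M_A/c_A]$, and $p_B^*$ minimizes $u_A(p_A^*,p_B)$ over $p_B\in[0,M_B/c_B]$.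 Put $$\bar p_A=\frac{2(1-c_A)}{2-c_A}\,\frac{M_A}{c_A},\qquad \hat p_B(p_A)=\frac{M_B}{c_B}-\frac{M_B-c_Bp_A}{2-c_B}.$$ An *indifference threshold* is a $p_A\in(0,M_A/c_A]$ with $\hat p_B(p_A)\in[0,M_B/c_B]$ and $u_B(p_A,0)=u_B(p_A,\hat p_B(p_A))$. **Proposition.** 0. If $\frac{M_B}{c_B}\le\frac{M_A}{c_A}$, then $(P,R)=(\bar p_A,\,M_A-c_A\bar p_A)$ is the unique maximizer of $\pi_A^*(P,R,M_B)$ over all $P,R\ge0$ with $R+c_AP\le M_A$; that is, $\bar p_A$ is $A$'s optimal investment when $B$ does not pre-allocate. 1. If $\frac{M_B}{c_B}\le M_A$, the unique Stackelberg equilibrium is $(p_A^*,p_B^*)=(\bar p_A,0)$. 2. If $M_A<\frac{M_B}{c_B}<\frac{M_A}{c_A}$, there is exactly one indifference threshold $p_A^\dagger$. If $p_A^\dagger<\bar p_A$, the unique Stackelberg equilibrium is $(\bar p_A,0)$. If $p_A^\dagger\ge\bar p_A$, the Stackelberg equilibria are exactly $(p_A^\dagger,0)$ and $(p_A^\dagger,\hat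 p_B(p_A^\dagger))$. If $\frac{M_B}{c_B}=\frac{M_A}{c_A}$, there is at most one indifference threshold; if $p_A^\dagger$ is one, then $p_A^\dagger\ge\bar p_A$, and $(p_A^\dagger,0)$ and $(p_A^\dagger,\hat p_B(p_A^\dagger))$ are Stackelberg equilibria. 3. If $\frac{M_A}{c_A}<\frac{M_B}{c_B}$, the unique Stackelberg equilibrium is $(0,\hat p_B(0))$. -/

import Mathlib

open scoped NNReal ENNReal
open MeasureTheory

noncomputable section

namespace Lotto

/-- Strategies in the single-battlefield General Lotto game: probability distributions of a
nonnegative allocation whose expected value does not exceed the budget `R`. -/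
def Strategy (R : ℝ) : Type :=
  {F : ProbabilityMeasure ℝ≥0 // ∫⁻ x, (x : ℝ≥0∞) ∂(F : Measure ℝ≥0) ≤ ENNReal.ofReal R}

/-- Expected payoff of player `A` with favoritism `p` (in favor of `A` when `p > 0`, of `B` when
`p < 0`), on one battlefield of unit value: the probability that `x_A + p ≥ x_B` when `x_A` and
`x_B` are drawn independently from the two strategies. -/
def payoffA (p : ℝ) {RA RB : ℝ} (FA : Strategy RA) (FB : Strategy RB) : ℝ :=
  ((FA.1 : Measure ℝ≥0).prod (FB.1 : Measure ℝ≥0)).real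
    {z : ℝ≥0 × ℝ≥0 | (z.2 : ℝ) ≤ (z.1 : ℝ) + p}

/-- Nash equilibrium of the (constant-sum) General Lotto game with favoritism; `B` receives
`1 - payoffA`. -/
def IsNash (p : ℝ) {RA RB : ℝ} (FA : Strategy RA) (FB : Strategy RB) : Prop :=
  (∀ FA' : Strategy RA, payoffA p FA' FB ≤ payoffA p FA FB) ∧
  (∀ FB' : Strategy RB, 1 - payoffA p FA FB' ≤ 1 - payoffA p FA FB)

/-- Player `A`'s equilibrium payoff `π_A^*(p, R_A, R_B)`, as the value of the constant-sum game.
It is the payoff of every Nash equilibrium (`IsNash.payoffA_eq_eqPayoffA`), and it also covers the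
degenerate zero budgets, for which the value need not be attained. -/
def eqPayoffA (p RA RB : ℝ) : ℝ :=
  ⨆ FA : Strategy RA, ⨅ FB : Strategy RB, payoffA p FA FB

theorem payoffA_nonneg (p : ℝ) {RA RB : ℝ} (FA : Strategy RA) (FB : Strategy RB) :
    0 ≤ payoffA p FA FB := measureReal_nonneg

theorem payoffA_le_one (p : ℝ) {RA RB : ℝ} (FA : Strategy RA) (FB : Strategy RB) :
    payoffA p FA FB ≤ 1 := measureReal_le_one

theorem IsNash.payoffA_eq_eqPayoffA {p RA RB : ℝ} {FA : Strategy RA} {FB : Strategy RB}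
    (h : IsNash p FA FB) : payoffA p FA FB = eqPayoffA p RA RB := by
  have hbelow : ∀ FA' : Strategy RA,
      BddBelow (Set.range fun FB' : Strategy RB => payoffA p FA' FB') :=
    fun FA' => ⟨0, by rintro _ ⟨FB', rfl⟩; exact payoffA_nonneg p FA' FB'⟩
  have : Nonempty (Strategy RA) := ⟨FA⟩
  have : Nonempty (Strategy RB) := ⟨FB⟩
  apply le_antisymm
  · have h1 : payoffA p FA FB ≤ ⨅ FB' : Strategy RB, payoffA p FA FB' :=
      le_ciInf fun FB' => by linarith [h.2 FB']
    refine h1.trans (le_ciSup (f := fun FA' : Strategy RA =>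
      ⨅ FB' : Strategy RB, payoffA p FA' FB') ⟨1, ?_⟩ FA)
    rintro _ ⟨FA', rfl⟩
    exact (ciInf_le (hbelow FA') FB).trans (payoffA_le_one p FA' FB)
  · exact ciSup_le fun FA' => (ciInf_le (hbelow FA') FB).trans (h.1 FA')

/-- `(P, R)` solves player `A`'s investment problem against real-time resources `RB`: it maximizes
`π_A^*(P, R, RB)` over all `P, R ≥ 0` with `R + cA * P ≤ MA`. -/
def IsOptimalInvestment (MA cA RB P R : ℝ) : Prop :=
  (0 ≤ P ∧ 0 ≤ R ∧ R + cA * P ≤ MA) ∧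
  ∀ P' R' : ℝ, 0 ≤ P' → 0 ≤ R' → R' + cA * P' ≤ MA → eqPayoffA P' R' RB ≤ eqPayoffA P R RB

/-- The pre-allocation `2(1 - c_A)/(2 - c_A) * M_A/c_A`. -/
def pBar (MA cA : ℝ) : ℝ := 2 * (1 - cA) / (2 - cA) * (MA / cA)

/-- Final payoff `u_A(p_A, p_B)` of player `A` in the Stackelberg game. -/
def uA (MA cA MB cB pA pB : ℝ) : ℝ :=
  eqPayoffA (pA - pB) (MA - cA * pA) (MB - cB * pB)

/-- Final payoff `u_B(p_A, p_B)` of player `B` in the Stackelberg game. -/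
def uB (MA cA MB cB pA pB : ℝ) : ℝ := 1 - uA MA cA MB cB pA pB

/-- Stackelberg equilibrium: `pA` maximizes over `[0, MA/cA]` the worst-case payoff
`inf_{p_B} u_A(·, p_B)`, and `pB` is a minimizer of `u_A(pA, ·)` over `[0, MB/cB]`. -/
def IsStackelberg (MA cA MB cB pA pB : ℝ) : Prop :=
  (pA ∈ Set.Icc 0 (MA / cA) ∧
    IsMaxOn (fun q => sInf (uA MA cA MB cB q '' Set.Icc 0 (MB / cB)))
      (Set.Icc 0 (MA / cA)) pA) ∧
  (pB ∈ Set.Icc 0 (MB / cB) ∧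
    IsMinOn (fun q => uA MA cA MB cB pA q) (Set.Icc 0 (MB / cB)) pB)

/-- The response `p̂_B` to the pre-allocation `pA`. -/
def pHat (MB cB pA : ℝ) : ℝ := MB / cB - (MB - cB * pA) / (2 - cB)

/-- `pA ∈ (0, MA/cA]` is an indifference threshold: `p̂_B` is a feasible response to `pA`, and `B`
is indifferent between it and not responding. -/
def IsIndifference (MA cA MB cB pA : ℝ) : Prop :=
  pA ∈ Set.Ioc 0 (MA / cA) ∧ pHat MB cB pA ∈ Set.Icc 0 (MB / cB) ∧
  uB MA cA MB cB pA 0 = uB MA cA MB cB pA (pHat MB cB pA)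

end Lotto

end

/-!
A strategy with an atom at `0` and a uniform density `δ` on an interval has a distribution function
below an affine function, and against an affine function an opponent's budget, which only constrains
a mean, translates into a bound on its payoff. Strategies of this kind for both players determine
the value of the game, and since every other choice of `δ` and of the interval still gives a bound,
they also yield the inequalities that compare values. Those which guarantee a given payoff form a
convex set after passing to `1 / δ`, as the budget constraint becomes a rotated cone; hence the
value is semistrictly quasiconcave in the head start and the budgets.

A player who responds to a pre-allocation therefore either does nothing, or offsets it completely
and then invests optimally, which is `pHat`. In the regime that matters, the difference between the
payoffs of the first player after these two responses is a concave function of its pre-allocation,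
so it changes sign once, at the indifference threshold. Below the threshold the first player is held
to its payoff against `pHat`, which is a monotone function of the pre-allocation; from there on it
faces no response, and its payoff decreases beyond `pBar`.
-/

noncomputable section

namespace Lotto

section certificates

/-- The distribution with density `δ` on `[l, l + h]` and its remaining mass in an atom at `0`. The
equilibrium strategies of the Lotto game have this form. -/
def atomUniform (δ l h : ℝ) : Measure ℝ≥0 :=
  ENNReal.ofReal (1 - δ * h) • Measure.dirac 0 +
    ENNReal.ofReal δ • (volume.restrict (Set.Icc l (l + h))).map Real.toNNReal

theorem isProbabilityMeasure_atomUniform {δ l h : ℝ} (hδ : 0 ≤ δ) (hh : 0 ≤ h)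
    (hδh : δ * h ≤ 1) : IsProbabilityMeasure (atomUniform δ l h) := by
  refine ⟨?_⟩
  simp only [atomUniform, Measure.add_apply, Measure.smul_apply, measure_univ, smul_eq_mul,
    mul_one, Measure.map_apply measurable_real_toNNReal MeasurableSet.univ, Set.preimage_univ,
    Measure.restrict_apply_univ, Real.volume_Icc, add_sub_cancel_left]
  rw [← ENNReal.ofReal_mul hδ, ← ENNReal.ofReal_add (by linarith) (by positivity)]
  simp

theorem lintegral_atomUniform {δ l h : ℝ} (hδ : 0 ≤ δ) (hl : 0 ≤ l) (hh : 0 ≤ h) :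
    ∫⁻ x, (x : ℝ≥0∞) ∂(atomUniform δ l h) = ENNReal.ofReal (δ * h * (l + h / 2)) := by
  have hmean : ∫⁻ u in Set.Icc l (l + h), ENNReal.ofReal u = ENNReal.ofReal (h * (l + h / 2)) := by
    rw [← ofReal_integral_eq_lintegral_ofReal (f := fun u => u)
        continuous_id.integrableOn_Icc ((ae_restrict_iff' measurableSet_Icc).2
          (ae_of_all _ fun u hu => hl.trans hu.1)),
      integral_Icc_eq_integral_Ioc, ← intervalIntegral.integral_of_le (by linarith), integral_id]
    ring_nf
  rw [atomUniform, lintegral_add_measure, lintegral_smul_measure, lintegral_smul_measure,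
    lintegral_map (by fun_prop) measurable_real_toNNReal, lintegral_dirac, ENNReal.coe_zero,
    smul_zero, zero_add, smul_eq_mul, mul_assoc, ENNReal.ofReal_mul hδ, ← hmean]
  rfl

theorem atomUniform_real_le {δ l h : ℝ} (hδ : 0 ≤ δ) (hδh : δ * h ≤ 1) (t : ℝ) :
    (atomUniform δ l h).real {x : ℝ≥0 | (x : ℝ) ≤ t} ≤ 1 - δ * h + δ * max 0 (t - l) := by
  have hm : MeasurableSet {x : ℝ≥0 | (x : ℝ) ≤ t} :=
    measurableSet_le (by fun_prop) measurable_const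
  have hmax : 0 ≤ δ * max 0 (t - l) := mul_nonneg hδ (le_max_left _ _)
  refine ENNReal.toReal_le_of_le_ofReal (by linarith) ?_
  rw [atomUniform, Measure.add_apply, Measure.smul_apply, Measure.smul_apply,
    Measure.map_apply measurable_real_toNNReal hm, smul_eq_mul, smul_eq_mul,
    ENNReal.ofReal_add (by linarith) hmax, ENNReal.ofReal_mul hδ,
    Measure.restrict_apply (measurable_real_toNNReal hm)]
  gcongr
  · exact mul_le_of_le_one_right (by simp) prob_le_one
  · have hsub : Real.toNNReal ⁻¹' {x : ℝ≥0 | (x : ℝ) ≤ t} ∩ Set.Icc l (l + h) ⊆ Set.Icc l t :=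
      fun u ⟨hut, hlu, _⟩ => ⟨hlu, (Real.le_coe_toNNReal u).trans hut⟩
    calc volume (Real.toNNReal ⁻¹' {x : ℝ≥0 | (x : ℝ) ≤ t} ∩ Set.Icc l (l + h))
        ≤ volume (Set.Icc l t) := measure_mono hsub
      _ ≤ ENNReal.ofReal (max 0 (t - l)) := by
        rw [Real.volume_Icc]
        exact ENNReal.ofReal_le_ofReal (le_max_right _ _)

/-- The strategy with density `δ` on `[l, l + h]`, for a budget that covers its mean. -/
def atomUniformStrategy {δ l h R : ℝ} (hδ : 0 ≤ δ) (hl : 0 ≤ l) (hh : 0 ≤ h) (hδh : δ * h ≤ 1)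
    (hR : δ * h * (l + h / 2) ≤ R) : Strategy R :=
  ⟨⟨atomUniform δ l h, isProbabilityMeasure_atomUniform hδ hh hδh⟩, by
    simpa only [ProbabilityMeasure.coe_mk, lintegral_atomUniform hδ hl hh] using
      ENNReal.ofReal_le_ofReal hR⟩

instance (R : ℝ) : Nonempty (Strategy R) :=
  ⟨⟨⟨Measure.dirac 0, inferInstance⟩, by simp⟩⟩

theorem Strategy.lintegral_le {R α β : ℝ} (F : Strategy R) (hR : 0 ≤ R) (hα : 0 ≤ α)
    (hβ : 0 ≤ β) {φ : ℝ≥0 → ℝ≥0∞} (hφ : ∀ z : ℝ≥0, φ z ≤ ENNReal.ofReal (α + β * z)) :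
    ∫⁻ z, φ z ∂(F.1 : Measure ℝ≥0) ≤ ENNReal.ofReal (α + β * R) := by
  calc ∫⁻ z, φ z ∂(F.1 : Measure ℝ≥0)
      ≤ ∫⁻ z, (ENNReal.ofReal α + ENNReal.ofReal β * (z : ℝ≥0∞)) ∂(F.1 : Measure ℝ≥0) := by
        refine lintegral_mono fun z => (hφ z).trans_eq ?_
        rw [ENNReal.ofReal_add hα (by positivity), ENNReal.ofReal_mul hβ, ENNReal.ofReal_coe_nnreal]
    _ = ENNReal.ofReal α + ENNReal.ofReal β * ∫⁻ z, (z : ℝ≥0∞) ∂(F.1 : Measure ℝ≥0) := by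
        rw [lintegral_add_left measurable_const, lintegral_const_mul _ (by fun_prop),
          lintegral_const, measure_univ, mul_one]
    _ ≤ ENNReal.ofReal α + ENNReal.ofReal β * ENNReal.ofReal R := by
        gcongr
        exact F.2
    _ = ENNReal.ofReal (α + β * R) := by
        rw [ENNReal.ofReal_add hα (by positivity), ENNReal.ofReal_mul hβ]

/-- With budget `R`, a player can hold an opponent who has head start `q` and budget `S` down to
winning probability `v`. As the opponent's budget only constrains a mean, this is witnessed by a
strategy whose distribution function, shifted by `q`, has an affine majorant `α + β z` with
`α + β S ≤ v`. -/
def Secures (q R S v : ℝ) : Prop :=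
  ∃ (F : Strategy R) (α β : ℝ), 0 ≤ α ∧ 0 ≤ β ∧ α + β * S ≤ v ∧
    ∀ z : ℝ, 0 ≤ z → (F.1 : Measure ℝ≥0).real {x : ℝ≥0 | (x : ℝ) ≤ z + q} ≤ α + β * z

theorem measurableSet_win (p : ℝ) :
    MeasurableSet {z : ℝ≥0 × ℝ≥0 | (z.2 : ℝ) ≤ (z.1 : ℝ) + p} :=
  measurableSet_le (by fun_prop) (by fun_prop)

variable {p q RA RB R S v : ℝ}

theorem eqPayoffA_le_of_secures (hRA : 0 ≤ RA) (h : Secures p RB RA v) :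
    eqPayoffA p RA RB ≤ v := by
  obtain ⟨FB, α, β, hα, hβ, hv, hF⟩ := h
  have hpay (FA : Strategy RA) : payoffA p FA FB ≤ α + β * RA := by
    refine ENNReal.toReal_le_of_le_ofReal (by positivity) ?_
    rw [Measure.prod_apply (measurableSet_win p)]
    refine FA.lintegral_le hRA hα hβ fun z => ?_
    rw [← ENNReal.ofReal_toReal (measure_ne_top (FB.1 : Measure ℝ≥0) _)]
    exact ENNReal.ofReal_le_ofReal (hF z z.2)
  exact ciSup_le fun FA =>
    (ciInf_le ⟨0, Set.forall_mem_range.2 fun FB' => payoffA_nonneg p FA FB'⟩ FB).trans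
      ((hpay FA).trans hv)

theorem le_eqPayoffA_of_secures (hRB : 0 ≤ RB) (h : Secures (-p) RA RB v) :
    1 - v ≤ eqPayoffA p RA RB := by
  obtain ⟨FA, α, β, hα, hβ, hv, hF⟩ := h
  have hlose (FB : Strategy RB) : 1 - payoffA p FA FB ≤ α + β * RB := by
    rw [payoffA, ← probReal_compl_eq_one_sub (measurableSet_win p)]
    refine ENNReal.toReal_le_of_le_ofReal (by positivity) ?_
    rw [Measure.prod_apply_symm (measurableSet_win p).compl]
    refine FB.lintegral_le hRB hα hβ fun z => ?_
    refine (measure_mono (t := {x : ℝ≥0 | (x : ℝ) ≤ z + -p}) fun x hx => ?_).trans ?_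
    · simp only [Set.mem_preimage, Set.mem_compl_iff, Set.mem_ofPred_eq, not_le] at hx ⊢
      linarith
    · rw [← ENNReal.ofReal_toReal (measure_ne_top (FA.1 : Measure ℝ≥0) _)]
      exact ENNReal.ofReal_le_ofReal (hF z z.2)
  refine le_ciSup_of_le ⟨1, Set.forall_mem_range.2 fun FA' => ?_⟩ FA
    (le_ciInf fun FB => by linarith [hlose FB])
  exact (ciInf_le ⟨0, Set.forall_mem_range.2 fun FB' => payoffA_nonneg p FA' FB'⟩
    (Classical.arbitrary (Strategy RB))).trans (payoffA_le_one p FA' _)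

theorem Secures.mono {w : ℝ} (h : Secures q R S v) (hvw : v ≤ w) : Secures q R S w :=
  let ⟨F, α, β, hα, hβ, hv, hF⟩ := h
  ⟨F, α, β, hα, hβ, hv.trans hvw, hF⟩

/-- Density `δ` on `[0, h]` against an opponent with handicap `p`. -/
theorem secures_of_handicap {x y δ h : ℝ} (hp : 0 ≤ p) (hδ : 0 ≤ δ) (hh : 0 ≤ h)
    (hδh : δ * (h + p) ≤ 1) (hx : δ * h ^ 2 ≤ 2 * x) :
    Secures (-p) x y (1 - δ * (h + p - y)) := by
  have hδp : 0 ≤ δ * p := mul_nonneg hδ hp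
  refine ⟨atomUniformStrategy hδ le_rfl hh (by linarith) (by linarith), 1 - δ * (h + p), δ,
    by linarith, hδ, by linarith, fun z hz => ?_⟩
  rcases lt_or_ge z p with hzp | hpz
  · have hempty : {x : ℝ≥0 | (x : ℝ) ≤ z + -p} = ∅ :=
      Set.eq_empty_of_forall_notMem fun x hx => by
        have hx' : (x : ℝ) ≤ z + -p := hx
        linarith [x.coe_nonneg]
    rw [hempty, measureReal_empty]
    nlinarith
  · refine (atomUniform_real_le hδ (by linarith) _).trans_eq ?_
    rw [max_eq_right (by linarith)]
    ring

/-- Density `δ` on `[p, p + h]` against an opponent with head start `p`. -/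
theorem secures_of_headStart {x y δ h : ℝ} (hp : 0 ≤ p) (hδ : 0 ≤ δ) (hh : 0 ≤ h)
    (hδh : δ * h ≤ 1) (hy : δ * h * (2 * p + h) ≤ 2 * y) :
    Secures p y x (1 - δ * (h - x)) := by
  refine ⟨atomUniformStrategy hδ hp hh hδh (by linarith), 1 - δ * h, δ, by linarith, hδ,
    by linarith, fun z hz => (atomUniform_real_le hδ hδh _).trans_eq ?_⟩
  rw [add_sub_cancel_right, max_eq_right hz]

end certificates

section value

/-- The largest point `U` of the equilibrium support in the Lotto game in which the player with
budget `x` has the head start `p`; it is the larger root of `(U - p) ^ 2 = 2 * x * U`. -/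
def supportTop (p x : ℝ) : ℝ := x + p + √(x * (x + 2 * p))

/-- The equilibrium payoff of a player with head start `p ≥ 0` and budget `x` against an opponent
with budget `y`. The first regime is the one in which the opponent puts an atom at `0`. -/
def headStartValue (p x y : ℝ) : ℝ :=
  if y ≤ (p + supportTop p x) / 2 then 1 - y / supportTop p x else x / (2 * (y - p))

variable {p x y : ℝ}

theorem headStartValue_of_le (h : y ≤ (p + supportTop p x) / 2) :
    headStartValue p x y = 1 - y / supportTop p x := if_pos h

theorem headStartValue_of_lt (h : (p + supportTop p x) / 2 < y) :
    headStartValue p x y = x / (2 * (y - p)) := if_neg h.not_ge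

theorem sq_supportTop_sub (hp : 0 ≤ p) (hx : 0 ≤ x) :
    (supportTop p x - p) ^ 2 = 2 * x * supportTop p x := by
  have := Real.sq_sqrt (show 0 ≤ x * (x + 2 * p) by positivity)
  unfold supportTop
  linear_combination this

theorem two_mul_add_le_supportTop (hp : 0 ≤ p) (hx : 0 ≤ x) : 2 * x + p ≤ supportTop p x := by
  have : x ≤ √(x * (x + 2 * p)) := Real.le_sqrt_of_sq_le (by nlinarith)
  unfold supportTop
  linarith

theorem le_supportTop_of_sq_sub_le {σ : ℝ} (h : (σ - p) ^ 2 ≤ 2 * x * σ) :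
    σ ≤ supportTop p x := by
  have : σ - p - x ≤ √(x * (x + 2 * p)) := Real.le_sqrt_of_sq_le (by linarith)
  unfold supportTop
  linarith

theorem exists_density_headStartValue_eq (hp : 0 ≤ p) (hx : 0 ≤ x) (h : 0 < p + x + y) :
    ∃ δ h : ℝ, 0 ≤ δ ∧ 0 ≤ h ∧ δ * (h + p) ≤ 1 ∧ δ * h ^ 2 ≤ 2 * x ∧
      headStartValue p x y = δ * (h + p - y) := by
  have hU := two_mul_add_le_supportTop hp hx
  rcases le_or_gt y ((p + supportTop p x) / 2) with hy | hy
  · have hU0 : 0 < supportTop p x := by linarith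
    refine ⟨(supportTop p x)⁻¹, supportTop p x - p, by positivity, by linarith, ?_, ?_, ?_⟩
    · rw [sub_add_cancel, inv_mul_cancel₀ hU0.ne']
    · rw [sq_supportTop_sub hp hx, mul_comm, mul_inv_cancel_right₀ hU0.ne']
    · rw [headStartValue_of_le hy]
      field_simp
      ring
  · have hd : 0 < y - p := by linarith
    have hcap : x * (2 * (y - p) + p) ≤ 2 * (y - p) ^ 2 := by
      by_contra! hlt
      have := le_supportTop_of_sq_sub_le (σ := 2 * (y - p) + p) (p := p) (x := x) (by linarith)
      linarith
    refine ⟨x / (2 * (y - p) ^ 2), 2 * (y - p), by positivity, by positivity, ?_, ?_, ?_⟩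
    · rw [div_mul_eq_mul_div]
      exact div_le_one_of_le₀ hcap (by positivity)
    · exact le_of_eq (by field_simp)
    · rw [headStartValue_of_lt hy]
      field_simp
      ring

theorem secures_headStartValue_of_le (hp : 0 ≤ p) (hx : 0 < x) (hy : 0 ≤ y)
    (h : y ≤ (p + supportTop p x) / 2) : Secures p y x (headStartValue p x y) := by
  have hU := two_mul_add_le_supportTop hp hx.le
  have hsq := sq_supportTop_sub hp hx.le
  rw [headStartValue_of_le h]
  generalize supportTop p x = U at *
  have hU0 : 0 < U := by linarith
  have hUp : 0 < U - p := by linarith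
  have hpU : 0 < p + U := by linarith
  have hδh : 2 * y / ((p + U) * (U - p)) * (U - p) = 2 * y / (p + U) := by field_simp
  refine (secures_of_headStart (δ := 2 * y / ((p + U) * (U - p))) hp (by positivity) hUp.le
    ?_ ?_).mono (le_of_eq ?_)
  · rw [hδh, div_le_one₀ hpU]
    linarith
  · rw [hδh]
    exact le_of_eq (by field_simp; ring)
  · field_simp
    linear_combination (-y) * hsq

theorem secures_headStartValue_of_lt (hp : 0 ≤ p) (hx : 0 ≤ x)
    (h : (p + supportTop p x) / 2 < y) : Secures p y x (headStartValue p x y) := by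
  have hd : 0 < y - p := by linarith [two_mul_add_le_supportTop hp hx]
  refine (secures_of_headStart (δ := (2 * (y - p))⁻¹) (h := 2 * (y - p)) hp (by positivity)
    (by positivity) (inv_mul_cancel₀ (by positivity)).le ?_).mono (le_of_eq ?_)
  · rw [inv_mul_cancel₀ (by positivity)]
    linarith
  · rw [headStartValue_of_lt h]
    field_simp
    ring

/-- Against a budget `x = 0` the opponent has to bid slightly above `p`, whence the loss `ε`. -/
theorem secures_headStartValue_add (hp : 0 ≤ p) (hx : 0 ≤ x) (hy : 0 ≤ y) {ε : ℝ} (hε : 0 < ε) :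
    Secures p y x (headStartValue p x y + ε) := by
  rcases lt_or_ge ((p + supportTop p x) / 2) y with h | h
  · exact (secures_headStartValue_of_lt hp hx h).mono (by linarith)
  rcases hx.lt_or_eq with hx | rfl
  · exact (secures_headStartValue_of_le hp hx hy h).mono (by linarith)
  have hU : supportTop p 0 = p := by simp [supportTop]
  rw [headStartValue_of_le h]
  rw [hU] at h ⊢
  rcases hp.eq_or_lt with rfl | hp
  · exact (secures_of_headStart (δ := 0) le_rfl le_rfl le_rfl (by simp) (by simpa)).mono
      (by simpa using hε.le)
  have hyp : y / p ≤ 1 := (div_le_one₀ hp).2 (by linarith)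
  have hmass : y / (2 * p ^ 2 * ε * (1 + ε)) * (2 * p * ε) = y / p / (1 + ε) := by field_simp
  refine (secures_of_headStart (δ := y / (2 * p ^ 2 * ε * (1 + ε))) (h := 2 * p * ε) hp.le
    (by positivity) (by positivity) ?_ ?_).mono ?_
  · rw [hmass]
    exact div_le_one_of_le₀ (by linarith) (by positivity)
  · rw [hmass]
    exact le_of_eq (by field_simp)
  · rw [sub_zero, hmass]
    have : y / p - y / p / (1 + ε) = y / p * (ε / (1 + ε)) := by field_simp; ring
    have : y / p * (ε / (1 + ε)) ≤ 1 * ε := by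
      gcongr
      exact div_le_self hε.le (by linarith)
    linarith

theorem eqPayoffA_zero : eqPayoffA 0 0 0 = 1 := by
  have hzero (F : Strategy 0) : ∀ᵐ z ∂(F.1 : Measure ℝ≥0), z = 0 := by
    have h0 : ∫⁻ z, (z : ℝ≥0∞) ∂(F.1 : Measure ℝ≥0) = 0 := by simpa using F.2
    filter_upwards [(lintegral_eq_zero_iff (by fun_prop)).1 h0] with z hz
    simpa using hz
  have hpay (FA FB : Strategy 0) : payoffA 0 FA FB = 1 := by
    refine (measureReal_congr (Filter.eventuallyEq_univ.2 ?_)).trans probReal_univ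
    filter_upwards [Measure.quasiMeasurePreserving_snd.ae (hzero FB)] with z hz
    simp [hz]
  simp only [eqPayoffA, hpay, ciInf_const, ciSup_const]

theorem eqPayoffA_of_nonneg (hp : 0 ≤ p) (hx : 0 ≤ x) (hy : 0 ≤ y) :
    eqPayoffA p x y = headStartValue p x y := by
  by_cases h : 0 < p + x + y
  · refine le_antisymm (le_of_forall_pos_le_add fun ε hε =>
      eqPayoffA_le_of_secures hx (secures_headStartValue_add hp hx hy hε)) ?_
    obtain ⟨δ, h, hδ, hh, hcap, hbudget, hV⟩ := exists_density_headStartValue_eq hp hx h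
    rw [hV]
    simpa only [sub_sub_cancel] using
      le_eqPayoffA_of_secures hy (secures_of_handicap (y := y) hp hδ hh hcap hbudget)
  · obtain ⟨rfl, rfl, rfl⟩ : p = 0 ∧ x = 0 ∧ y = 0 := ⟨by linarith, by linarith, by linarith⟩
    rw [eqPayoffA_zero, headStartValue_of_le (by simp [supportTop])]
    simp

theorem eqPayoffA_of_neg (hp : p < 0) (hx : 0 ≤ x) (hy : 0 ≤ y) :
    eqPayoffA p x y = 1 - headStartValue (-p) y x := by
  have hp' : 0 < -p := neg_pos.2 hp
  refine le_antisymm ?_ (le_of_forall_pos_le_add fun ε hε => ?_)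
  · obtain ⟨δ, h, hδ, hh, hcap, hbudget, hV⟩ :=
      exists_density_headStartValue_eq (y := x) hp'.le hy (by linarith)
    rw [hV]
    exact eqPayoffA_le_of_secures hx
      (by simpa using secures_of_handicap (y := x) hp'.le hδ hh hcap hbudget)
  · linarith [le_eqPayoffA_of_secures hy (secures_headStartValue_add hp'.le hy hx hε)]

theorem density_le_headStartValue {δ h : ℝ} (hp : 0 ≤ p) (hx : 0 ≤ x) (hy : 0 ≤ y) (hδ : 0 ≤ δ)
    (hh : 0 ≤ h) (hcap : δ * (h + p) ≤ 1) (hbudget : δ * h ^ 2 ≤ 2 * x) :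
    δ * (h + p - y) ≤ headStartValue p x y := by
  rw [← eqPayoffA_of_nonneg hp hx hy]
  linarith [le_eqPayoffA_of_secures hy (secures_of_handicap (y := y) hp hδ hh hcap hbudget)]

theorem headStartValue_le_density {δ h : ℝ} (hp : 0 ≤ p) (hx : 0 ≤ x) (hy : 0 ≤ y) (hδ : 0 ≤ δ)
    (hh : 0 ≤ h) (hcap : δ * h ≤ 1) (hbudget : δ * h * (2 * p + h) ≤ 2 * y) :
    headStartValue p x y ≤ 1 - δ * (h - x) := by
  rw [← eqPayoffA_of_nonneg hp hx hy]
  exact eqPayoffA_le_of_secures hx (secures_of_headStart hp hδ hh hcap hbudget)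

end value

section investment

variable {p x y c M : ℝ}

theorem headStartValue_lt_one (hp : 0 ≤ p) (hx : 0 ≤ x) (hy : 0 < y) :
    headStartValue p x y < 1 := by
  set δ := min (1 / (x + 1)) (2 * y / ((x + 1) * (2 * p + (x + 1))))
  have hδ : 0 < δ := lt_min (by positivity) (by positivity)
  have hcap : δ * (x + 1) ≤ 1 := (le_div_iff₀ (by positivity)).1 (min_le_left _ _)
  have hbudget : δ * ((x + 1) * (2 * p + (x + 1))) ≤ 2 * y :=
    (le_div_iff₀ (by positivity)).1 (min_le_right _ _)
  have := headStartValue_le_density (h := x + 1) hp hx hy.le hδ.le (by positivity) hcap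
    (by linarith)
  linarith

theorem headStartValue_pos (hp : 0 ≤ p) (hx : 0 < x) (hy : 0 ≤ y) : 0 < headStartValue p x y := by
  set δ := min (1 / (y + 1 + p)) (2 * x / (y + 1) ^ 2)
  have hδ : 0 < δ := lt_min (by positivity) (by positivity)
  have hcap : δ * (y + 1 + p) ≤ 1 := (le_div_iff₀ (by positivity)).1 (min_le_left _ _)
  have hbudget : δ * (y + 1) ^ 2 ≤ 2 * x := (le_div_iff₀ (by positivity)).1 (min_le_right _ _)
  have := density_le_headStartValue (h := y + 1) hp hx.le hy hδ.le (by positivity) hcap hbudget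
  nlinarith

theorem supportTop_zero_left (hx : 0 ≤ x) : supportTop 0 x = 2 * x := by
  rw [supportTop, mul_zero, add_zero, Real.sqrt_mul_self hx, two_mul]

theorem headStartValue_zero_of_le (hx : 0 ≤ x) (h : y ≤ x) :
    headStartValue 0 x y = 1 - y / (2 * x) := by
  rw [headStartValue_of_le, supportTop_zero_left hx]
  rw [supportTop_zero_left hx]
  linarith

theorem headStartValue_zero_of_lt (hx : 0 ≤ x) (h : x < y) :
    headStartValue 0 x y = x / (2 * y) := by
  rw [headStartValue_of_lt, sub_zero]
  rw [supportTop_zero_left hx]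
  linarith

theorem headStartValue_le_div (hp : 0 ≤ p) (hx : 0 ≤ x) (hpy : p < y) :
    headStartValue p x y ≤ x / (2 * (y - p)) := by
  have hd : 0 < y - p := sub_pos.2 hpy
  have hδh : (2 * (y - p))⁻¹ * (2 * (y - p)) = 1 := inv_mul_cancel₀ (by positivity)
  refine (headStartValue_le_density (δ := (2 * (y - p))⁻¹) (h := 2 * (y - p)) hp hx
    (hp.trans hpy.le) (by positivity) (by positivity) hδh.le ?_).trans_eq ?_
  · rw [hδh]
    linarith
  · field_simp
    ring

theorem pBar_pos (hM : 0 < M) (hc : c ∈ Set.Ioo (0 : ℝ) 1) : 0 < pBar M c := by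
  obtain ⟨hc0, hc1⟩ := hc
  have : 0 < 1 - c := by linarith
  have : 0 < 2 - c := by linarith
  unfold pBar
  positivity

theorem mul_pBar (hc : c ∈ Set.Ioo (0 : ℝ) 1) : c * pBar M c = M - M * c / (2 - c) := by
  have : c ≠ 0 := hc.1.ne'
  have : 2 - c ≠ 0 := by linarith [hc.2]
  unfold pBar
  field_simp
  ring

theorem mul_pBar_lt (hM : 0 < M) (hc : c ∈ Set.Ioo (0 : ℝ) 1) : c * pBar M c < M := by
  rw [mul_pBar hc]
  exact sub_lt_self M (div_pos (mul_pos hM hc.1) (by linarith [hc.2]))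

theorem supportTop_pBar (hM : 0 < M) (hc : c ∈ Set.Ioo (0 : ℝ) 1) :
    supportTop (pBar M c) (M - c * pBar M c) = 2 * M / (c * (2 - c)) := by
  have h2 : 2 - c ≠ 0 := by linarith [hc.2]
  have hc0 : c ≠ 0 := hc.1.ne'
  have hsq : (M - c * pBar M c) * (M - c * pBar M c + 2 * pBar M c) = M * M := by
    unfold pBar
    field_simp
    ring
  rw [supportTop, hsq, Real.sqrt_mul_self hM.le]
  unfold pBar
  field_simp
  ring

theorem headStartValue_pBar (hM : 0 < M) (hc : c ∈ Set.Ioo (0 : ℝ) 1) (h : c * y ≤ M) :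
    headStartValue (pBar M c) (M - c * pBar M c) y = 1 - y / (2 * M / (c * (2 - c))) := by
  have h2 : 2 - c ≠ 0 := by linarith [hc.2]
  have hc0 : c ≠ 0 := hc.1.ne'
  have hmid : (pBar M c + 2 * M / (c * (2 - c))) / 2 = M / c := by
    unfold pBar
    field_simp
    ring
  rw [headStartValue_of_le, supportTop_pBar hM hc]
  rw [supportTop_pBar hM hc, hmid, le_div_iff₀' hc.1]
  exact h

/-- The opponent plays as if the support reached up to `T = 2 * M / (c * (2 - c))`, as it does at
`pBar M c`; the gap is governed by `(p - pBar M c) ^ 2` and the unspent budget. -/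
theorem headStartValue_lt_of_two_mul_le (hM : 0 < M) (hc : c ∈ Set.Ioo (0 : ℝ) 1) (hp : 0 ≤ p)
    (hx : 0 ≤ x) (hxp : x + c * p ≤ M) (hy : 0 < y)
    (hne : ¬(p = pBar M c ∧ x = M - c * pBar M c))
    (h : 2 * y ≤ p + 2 * M / (c * (2 - c))) :
    headStartValue p x y < 1 - y / (2 * M / (c * (2 - c))) := by
  obtain ⟨hc0, hc1⟩ := hc
  have h2 : 0 < 2 - c := by linarith
  have hTM : 2 * M / (c * (2 - c)) * (c * (2 - c)) = 2 * M := by field_simp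
  have hpBar : pBar M c = (1 - c) * (2 * M / (c * (2 - c))) := by
    unfold pBar
    field_simp
  have hT0 : 0 < 2 * M / (c * (2 - c)) := by positivity
  rw [hpBar] at hne
  generalize 2 * M / (c * (2 - c)) = T at *
  have hMT : M < c * T := by nlinarith [mul_pos hc0 hT0]
  have hpT : p < T := by nlinarith
  have hgap : 0 < (p - (1 - c) * T) ^ 2 + 2 * T * (M - c * p - x) := by
    have hslack : 0 ≤ 2 * T * (M - c * p - x) := mul_nonneg (by positivity) (by linarith)
    rcases eq_or_ne p ((1 - c) * T) with hpe | hpe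
    · have hxe : x ≠ M - c * ((1 - c) * T) := fun hxe => hne ⟨hpe, hxe⟩
      have : 0 < M - c * p - x :=
        lt_of_le_of_ne (by linarith) fun h0 => hxe (by rw [← hpe]; linarith)
      positivity
    · have := sq_pos_of_ne_zero (sub_ne_zero.2 hpe)
      linarith
  have hTp : 0 < T - p := sub_pos.2 hpT
  have hδh : 2 * y / ((p + T) * (T - p)) * (T - p) = 2 * y / (p + T) := by field_simp
  refine (headStartValue_le_density (δ := 2 * y / ((p + T) * (T - p))) hp hx hy.le (by positivity)
    hTp.le ?_ ?_).trans_lt ?_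
  · rw [hδh]
    exact div_le_one_of_le₀ h (by positivity)
  · rw [hδh]
    exact le_of_eq (by field_simp; ring)
  · rw [sub_lt_sub_iff_left, div_mul_eq_mul_div, div_lt_div_iff₀ hT0 (by positivity)]
    have : 0 < y * ((p - (1 - c) * T) ^ 2 + 2 * T * (M - c * p - x)) := mul_pos hy hgap
    linear_combination this - y * T * hTM

theorem headStartValue_lt_of_lt_two_mul (hM : 0 < M) (hc : c ∈ Set.Ioo (0 : ℝ) 1) (hp : 0 ≤ p)
    (hx : 0 ≤ x) (hxp : x + c * p ≤ M) (hcy : c * y < M)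
    (h : p + 2 * M / (c * (2 - c)) < 2 * y) :
    headStartValue p x y < 1 - y / (2 * M / (c * (2 - c))) := by
  obtain ⟨hc0, hc1⟩ := hc
  have h2 : 0 < 2 - c := by linarith
  have hd : M / (2 - c) < y - p := by
    have hsplit : 2 * M / (c * (2 - c)) - M / c = M / (2 - c) := by field_simp; ring
    have hyM : y < M / c := (lt_div_iff₀' hc0).2 hcy
    linarith
  have hd0 : 0 < y - p := (div_pos hM h2).trans hd
  calc headStartValue p x y ≤ x / (2 * (y - p)) :=
        headStartValue_le_div hp hx (sub_pos.1 hd0)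
    _ ≤ (M - c * y + c * (y - p)) / (2 * (y - p)) := by gcongr; linarith
    _ = (M - c * y) / (2 * (y - p)) + c / 2 := by field_simp
    _ < (M - c * y) / (2 * (M / (2 - c))) + c / 2 := by
        have : 0 < M - c * y := sub_pos.2 hcy
        gcongr
    _ = 1 - y / (2 * M / (c * (2 - c))) := by field_simp; ring

theorem headStartValue_lt_of_ne_pBar (hM : 0 < M) (hc : c ∈ Set.Ioo (0 : ℝ) 1) (hp : 0 ≤ p)
    (hx : 0 ≤ x) (hxp : x + c * p ≤ M) (hy : 0 < y) (hcy : c * y < M)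
    (hne : ¬(p = pBar M c ∧ x = M - c * pBar M c)) :
    headStartValue p x y < headStartValue (pBar M c) (M - c * pBar M c) y := by
  rw [headStartValue_pBar hM hc hcy.le]
  rcases le_or_gt (2 * y) (p + 2 * M / (c * (2 - c))) with h | h
  · exact headStartValue_lt_of_two_mul_le hM hc hp hx hxp hy hne h
  · exact headStartValue_lt_of_lt_two_mul hM hc hp hx hxp hcy h

theorem headStartValue_le_of_weak (hp : 0 ≤ p) (hx : 0 ≤ x) (hc : 0 < c) (hy : 0 < y)
    (hxp : x + c * p ≤ c * y) : headStartValue p x y ≤ (x + c * p) / (2 * y) := by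
  rcases (show p ≤ y from le_of_mul_le_mul_left (by linarith) hc).eq_or_lt with rfl | hpy
  · obtain rfl : x = 0 := by linarith
    have hU : supportTop p 0 = p := by simp [supportTop]
    rw [headStartValue_of_le (by rw [hU]; linarith), hU, div_self hy.ne', sub_self]
    positivity
  · refine (headStartValue_le_div hp hx hpy).trans ?_
    rw [div_le_div_iff₀ (by linarith) (by positivity)]
    nlinarith [mul_nonneg hp (sub_nonneg.2 hxp)]

theorem headStartValue_lt_one_sub (hp : 0 < p) (hx : 0 < x) (hc0 : 0 < c) (hc1 : c ≤ 1) (hy : 0 < y)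
    (h : y - c * p ≤ c * x) : headStartValue p x y < 1 - (y - c * p) / (2 * x) := by
  have hyxp : y ≤ x + p := by nlinarith
  have hδh : 2 * y / ((2 * x + p) * (2 * x + 3 * p)) * (2 * x + p) = 2 * y / (2 * x + 3 * p) := by
    field_simp
  refine (headStartValue_le_density (δ := 2 * y / ((2 * x + p) * (2 * x + 3 * p)))
    (h := 2 * x + p) hp.le hx.le hy.le (by positivity) (by positivity) ?_ ?_).trans_lt ?_
  · rw [hδh]
    exact div_le_one_of_le₀ (by linarith) (by positivity)
  · rw [hδh]
    exact le_of_eq (by field_simp; ring)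
  · rw [sub_lt_sub_iff_left, div_mul_eq_mul_div, div_lt_div_iff₀ (by positivity) (by positivity)]
    have hgap : 0 < c * x * p ^ 2 := by positivity
    have hslack : 0 ≤ (c * x - (y - c * p)) * (4 * x * p + 3 * p ^ 2) :=
      mul_nonneg (sub_nonneg.2 h) (by positivity)
    linear_combination hgap + hslack

theorem div_lt_headStartValue_zero (hx : 0 < x) (hc : c ∈ Set.Ioo (0 : ℝ) 1) (h : c * x < y) :
    x * (c * (2 - c)) / (2 * y) < headStartValue 0 x y := by
  have hy : 0 < y := (mul_pos hc.1 hx).trans h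
  rcases le_or_gt y x with hyx | hxy
  · rw [headStartValue_zero_of_le hx.le hyx, ← sub_pos]
    have : 1 - y / (2 * x) - x * (c * (2 - c)) / (2 * y)
        = (y - c * x) * ((2 - c) * x - y) / (2 * x * y) := by
      field_simp
      ring
    rw [this]
    have : 0 < (2 - c) * x - y := by nlinarith [mul_pos (sub_pos.2 hc.2) hx]
    have : 0 < y - c * x := sub_pos.2 h
    positivity
  · rw [headStartValue_zero_of_lt hx.le hxy]
    gcongr
    nlinarith [mul_pos hx (sq_pos_of_pos (sub_pos.2 hc.2))]

end investment

section concavity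

variable {p₀ p₁ x₀ x₁ y₀ y₁ s t : ℝ}

theorem sq_combo_le_of_sq_le {h₀ h₁ σ₀ σ₁ : ℝ} (hs : 0 ≤ s) (ht : 0 ≤ t) (hx₀ : 0 ≤ x₀)
    (hx₁ : 0 ≤ x₁) (hσ₀ : 0 ≤ σ₀) (hσ₁ : 0 ≤ σ₁) (hh₀ : h₀ ^ 2 ≤ 2 * x₀ * σ₀)
    (hh₁ : h₁ ^ 2 ≤ 2 * x₁ * σ₁) :
    (s * h₀ + t * h₁) ^ 2 ≤ 2 * (s * x₀ + t * x₁) * (s * σ₀ + t * σ₁) := by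
  have hcross : h₀ * h₁ ≤ x₀ * σ₁ + x₁ * σ₀ := by
    refine abs_le_of_sq_le_sq' ?_ (by positivity) |>.2
    calc (h₀ * h₁) ^ 2 = h₀ ^ 2 * h₁ ^ 2 := mul_pow _ _ _
      _ ≤ 2 * x₀ * σ₀ * (2 * x₁ * σ₁) := by gcongr
      _ ≤ (x₀ * σ₁ + x₁ * σ₀) ^ 2 := by linarith [sq_nonneg (x₀ * σ₁ - x₁ * σ₀)]
  have h0 := mul_le_mul_of_nonneg_left hh₀ (sq_nonneg s)
  have h1 := mul_le_mul_of_nonneg_left hh₁ (sq_nonneg t)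
  have h01 := mul_le_mul_of_nonneg_left hcross (mul_nonneg hs ht)
  linear_combination h0 + h1 + 2 * h01

theorem concaveOn_supportTop :
    ConcaveOn ℝ (Set.Ici (0 : ℝ) ×ˢ Set.Ici (0 : ℝ)) fun z => supportTop z.1 z.2 := by
  refine ⟨(convex_Ici 0).prod (convex_Ici 0), ?_⟩
  rintro ⟨p₀, x₀⟩ ⟨hp₀ : 0 ≤ p₀, hx₀ : 0 ≤ x₀⟩ ⟨p₁, x₁⟩ ⟨hp₁ : 0 ≤ p₁, hx₁ : 0 ≤ x₁⟩ s t hs ht -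
  have hU₀ := two_mul_add_le_supportTop hp₀ hx₀
  have hU₁ := two_mul_add_le_supportTop hp₁ hx₁
  have := sq_combo_le_of_sq_le hs ht hx₀ hx₁ (by linarith) (by linarith)
    (sq_supportTop_sub hp₀ hx₀).le (sq_supportTop_sub hp₁ hx₁).le
  exact le_supportTop_of_sq_sub_le (by
    simp only [Prod.smul_mk, Prod.mk_add_mk, smul_eq_mul]
    linarith)

theorem concaveOn_supportTop_budgetLine (c M : ℝ) :
    ConcaveOn ℝ {a | 0 ≤ a ∧ c * a ≤ M} fun a => supportTop a (M - c * a) := by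
  have hline (a b s t : ℝ) (hst : s + t = 1) :
      M - c * (s * a + t * b) = s * (M - c * a) + t * (M - c * b) := by
    linear_combination (-M) * hst
  refine ⟨fun a ⟨ha, hca⟩ b ⟨hb, hcb⟩ s t hs ht hst => ⟨?_, ?_⟩,
    fun a ⟨ha, hca⟩ b ⟨hb, hcb⟩ s t hs ht hst => ?_⟩
  · exact add_nonneg (mul_nonneg hs ha) (mul_nonneg ht hb)
  · rw [← sub_nonneg, smul_eq_mul, smul_eq_mul, hline a b s t hst]
    exact add_nonneg (mul_nonneg hs (sub_nonneg.2 hca)) (mul_nonneg ht (sub_nonneg.2 hcb))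
  · simp only [smul_eq_mul]
    rw [hline a b s t hst]
    exact concaveOn_supportTop.2 (x := (a, M - c * a)) (y := (b, M - c * b))
      ⟨ha, sub_nonneg.2 hca⟩ ⟨hb, sub_nonneg.2 hcb⟩ hs ht hst

theorem exists_scale_headStartValue_eq {p x y : ℝ} (hp : 0 ≤ p) (hx : 0 ≤ x)
    (hpos : 0 < p + x + y) (hV : 0 < headStartValue p x y) :
    ∃ σ h : ℝ, 0 < σ ∧ 0 ≤ h ∧ h + p ≤ σ ∧ h ^ 2 ≤ 2 * x * σ ∧
      headStartValue p x y * σ = h + p - y := by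
  obtain ⟨δ, h, hδ, hh, hcap, hbudget, hV'⟩ := exists_density_headStartValue_eq hp hx hpos
  rcases hδ.eq_or_lt with rfl | hδ
  · rw [hV', zero_mul] at hV
    exact absurd hV (lt_irrefl 0)
  refine ⟨1 / δ, h, by positivity, hh, ?_, ?_, ?_⟩
  · rwa [le_div_iff₀' hδ]
  · rwa [mul_one_div, le_div_iff₀' hδ]
  · rw [hV']
    field_simp

/-- The densities `δ` on `[0, h]` that guarantee `r` correspond to the points `(σ, h)`, `σ = 1 / δ`,
of a set cut out by linear inequalities and a rotated cone; hence `headStartValue` is semistrictly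
quasiconcave. -/
theorem lt_headStartValue_combo {r : ℝ} (hp₀ : 0 ≤ p₀) (hx₀ : 0 ≤ x₀) (hy₀ : 0 ≤ y₀)
    (hpos₀ : 0 < p₀ + x₀ + y₀) (hp₁ : 0 ≤ p₁) (hx₁ : 0 ≤ x₁) (hy₁ : 0 ≤ y₁)
    (hpos₁ : 0 < p₁ + x₁ + y₁) (hr : 0 < r) (h₀ : r < headStartValue p₀ x₀ y₀)
    (h₁ : r ≤ headStartValue p₁ x₁ y₁) (hs : 0 < s) (ht : 0 ≤ t) :
    r < headStartValue (s * p₀ + t * p₁) (s * x₀ + t * x₁) (s * y₀ + t * y₁) := by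
  obtain ⟨σ₀, l₀, hσ₀, hl₀, hcap₀, hcone₀, hV₀⟩ :=
    exists_scale_headStartValue_eq hp₀ hx₀ hpos₀ (hr.trans h₀)
  obtain ⟨σ₁, l₁, hσ₁, hl₁, hcap₁, hcone₁, hV₁⟩ :=
    exists_scale_headStartValue_eq hp₁ hx₁ hpos₁ (hr.trans_le h₁)
  have hcone := sq_combo_le_of_sq_le hs.le ht hx₀ hx₁ hσ₀.le hσ₁.le hcone₀ hcone₁
  have hσ : 0 < s * σ₀ + t * σ₁ := by positivity
  have hcap := add_le_add (mul_le_mul_of_nonneg_left hcap₀ hs.le)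
    (mul_le_mul_of_nonneg_left hcap₁ ht)
  have hguarantee : r * (s * σ₀ + t * σ₁)
      < s * l₀ + t * l₁ + (s * p₀ + t * p₁) - (s * y₀ + t * y₁) := by
    have e₀ : s * (r * σ₀) < s * (l₀ + p₀ - y₀) := by rw [← hV₀]; gcongr
    have e₁ : t * (r * σ₁) ≤ t * (l₁ + p₁ - y₁) := by rw [← hV₁]; gcongr
    linarith
  calc r < 1 / (s * σ₀ + t * σ₁)
          * (s * l₀ + t * l₁ + (s * p₀ + t * p₁) - (s * y₀ + t * y₁)) := by
        rwa [one_div_mul_eq_div, lt_div_iff₀ hσ]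
    _ ≤ _ := by
      refine density_le_headStartValue (by positivity) (by positivity) (by positivity)
        (by positivity) (by positivity) ?_ ?_
      · rw [one_div_mul_eq_div, div_le_one₀ hσ]
        linarith
      · rwa [one_div_mul_eq_div, div_le_iff₀ hσ]

theorem lt_headStartValue_line {x c n k q p a r : ℝ} (hq : 0 ≤ q) (hqp : q < p) (hpa : p < a)
    (hxq : 0 ≤ x - c * q) (hxa : 0 ≤ x - c * a) (hnq : 0 ≤ n + k * q) (hna : 0 ≤ n + k * a)
    (hpos : 0 < q + (x - c * q) + (n + k * q)) (hr : 0 < r)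
    (h₀ : r < headStartValue q (x - c * q) (n + k * q))
    (h₁ : r ≤ headStartValue a (x - c * a) (n + k * a)) :
    r < headStartValue p (x - c * p) (n + k * p) := by
  have haq : a - q ≠ 0 := by linarith
  have := lt_headStartValue_combo (s := (a - p) / (a - q)) (t := (p - q) / (a - q)) hq hxq hnq hpos
    (by linarith) hxa hna (by linarith) hr h₀ h₁ (div_pos (by linarith) (by linarith))
    (div_nonneg (by linarith) (by linarith))
  convert this using 1
  congr 1 <;> field_simp <;> ring

theorem headStartValue_zero_right {p x : ℝ} (hp : 0 ≤ p) (hx : 0 ≤ x) :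
    headStartValue p x 0 = 1 := by
  have hU := two_mul_add_le_supportTop hp hx
  rw [headStartValue_of_le (by linarith), zero_div, sub_zero]

/-- The opponent reduces the head start from `a` to `p` at the unit price `k`. By semistrict
quasiconcavity along the line `q ↦ (q, n + k * q)`, an end of the line serves it better. -/
theorem headStartValue_lt_or_headStartValue_zero_le {p a x n k : ℝ} (hx : 0 < x) (hk : 0 ≤ k)
    (hp : 0 ≤ p) (hpa : p < a) (hn : 0 ≤ n + k * p) :
    headStartValue a x (n + k * a) < headStartValue p x (n + k * p) ∨
      0 ≤ n ∧ headStartValue 0 x n ≤ headStartValue p x (n + k * p) := by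
  by_contra! hcon
  obtain ⟨hle, hzero⟩ := hcon
  have ha : 0 < a := hp.trans_lt hpa
  have hna : 0 ≤ n + k * a := hn.trans (by gcongr)
  have hbetween {q : ℝ} (hq : 0 ≤ q) (hqp : q < p) (hnq : 0 ≤ n + k * q) :
      headStartValue q x (n + k * q) ≤ headStartValue p x (n + k * p) := by
    by_contra! hlt
    have := lt_headStartValue_line (x := x) (c := 0) hq hqp hpa (by linarith) (by linarith) hnq hna
      (by linarith) (headStartValue_pos hp hx hn) (by simpa using hlt) (by simpa using hle)
    simp at this
  rcases le_or_gt 0 n with hn0 | hn0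
  · refine (hzero hn0).not_ge ?_
    rcases hp.eq_or_lt with rfl | hp
    · simp
    · simpa using hbetween le_rfl hp (by simpa)
  have hk0 : 0 < k := pos_of_mul_pos_left (show 0 < k * p by linarith) hp
  rcases hn.eq_or_lt with hn | hn
  · rw [← hn, headStartValue_zero_right hp hx.le] at hle
    exact (headStartValue_lt_one ha.le hx.le (hn.trans_lt (by gcongr))).not_ge hle
  · have hq : n + k * (-n / k) = 0 := by field_simp; ring
    have hqp : -n / k < p := by rw [div_lt_iff₀' hk0]; linarith
    have hq0 : 0 ≤ -n / k := div_nonneg (by linarith) hk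
    have := hbetween hq0 hqp hq.ge
    rw [hq, headStartValue_zero_right hq0 hx.le] at this
    exact (headStartValue_lt_one hp hx.le hn).not_ge this

theorem headStartValue_lt_of_pBar_le {M c m a b : ℝ} (hM : 0 < M) (hc : c ∈ Set.Ioo (0 : ℝ) 1)
    (hm : 0 < m) (hcm : c * m < M) (ha : pBar M c ≤ a) (hab : a < b) (hb : c * b ≤ M) :
    headStartValue b (M - c * b) m < headStartValue a (M - c * a) m := by
  have hp := pBar_pos hM hc
  have hpM := mul_pBar_lt hM hc
  have hca : c * a < c * b := mul_lt_mul_of_pos_left hab hc.1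
  have hmax := headStartValue_lt_of_ne_pBar (y := m) hM hc (by linarith) (sub_nonneg.2 hb)
    (by linarith) hm hcm fun h => (ha.trans_lt hab).ne' h.1
  rcases ha.eq_or_lt with rfl | ha
  · exact hmax
  rcases le_or_gt (headStartValue b (M - c * b) m) 0 with hV | hV
  · exact hV.trans_lt (headStartValue_pos (by linarith) (by linarith) hm.le)
  · simpa using lt_headStartValue_line (n := m) (k := 0) hp.le ha hab (by linarith) (by linarith)
      (by linarith) (by linarith) (by linarith) hV (by simpa using hmax) (by simp)

end concavity

section offset

theorem convexOn_inv_of_concaveOn {s : Set ℝ} {f : ℝ → ℝ} (hf : ConcaveOn ℝ s f)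
    (hpos : ∀ z ∈ s, 0 < f z) : ConvexOn ℝ s fun z => (f z)⁻¹ := by
  refine ⟨hf.1, fun a ha b hb s t hs ht hst => ?_⟩
  have hcombo := (convex_Ioi (0 : ℝ)) (hpos a ha) (hpos b hb) hs ht hst
  have hinv := (convexOn_zpow (-1)).2 (hpos a ha) (hpos b hb) hs ht hst
  simp only [zpow_neg_one] at hinv
  exact (inv_anti₀ hcombo (hf.2 ha hb hs ht hst)).trans hinv

variable {M c m k a b : ℝ}

/-- The payoff of a player with capital `M` and unit price `c` who commits to the pre-allocation `a`
when an opponent with capital `m` and unit price `k` responds with `pHat m k a`: the opponent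
offsets `a` and invests optimally from there. -/
def offsetValue (M c m k a : ℝ) : ℝ := (M - c * a) * (k * (2 - k)) / (2 * (m - k * a))

theorem offsetValue_lt_iff (hk : k ∈ Set.Ioo (0 : ℝ) 1) (ha : k * a < m) (hb : k * b < m) :
    offsetValue M c m k a < offsetValue M c m k b ↔ 0 < (b - a) * (k * M - c * m) := by
  have hk2 : 0 < k * (2 - k) := mul_pos hk.1 (by linarith [hk.2])
  have hcross : (M - c * b) * (k * (2 - k)) * (2 * (m - k * a)) -
      (M - c * a) * (k * (2 - k)) * (2 * (m - k * b))
      = 2 * (k * (2 - k)) * ((b - a) * (k * M - c * m)) := by ring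
  unfold offsetValue
  rw [div_lt_div_iff₀ (by linarith) (by linarith), ← sub_pos, hcross]
  exact mul_pos_iff_of_pos_left (by positivity)

theorem offsetValue_le_iff (hk : k ∈ Set.Ioo (0 : ℝ) 1) (ha : k * a < m) (hb : k * b < m) :
    offsetValue M c m k a ≤ offsetValue M c m k b ↔ (a - b) * (k * M - c * m) ≤ 0 := by
  rw [← not_lt, offsetValue_lt_iff hk hb ha, not_lt]

theorem convexOn_offsetValue (hk : k ≤ 2) (hcm : c * m ≤ k * M) :
    ConvexOn ℝ {a | k * a < m} (offsetValue M c m k) := by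
  have hconv : Convex ℝ {a | k * a < m} := convex_halfSpace_lt (IsLinearMap.isLinearMap_smul k) m
  have hlin : ConcaveOn ℝ {a | k * a < m} fun a => m - k * a :=
    (concaveOn_const m hconv).sub ((LinearMap.mul ℝ ℝ k).convexOn hconv)
  have hinv := convexOn_inv_of_concaveOn hlin fun a ha => sub_pos.2 ha
  have hcoeff : 0 ≤ (2 - k) / 2 * (k * M - c * m) :=
    mul_nonneg (by linarith) (sub_nonneg.2 hcm)
  refine ((hinv.smul hcoeff).add_const ((2 - k) / 2 * c)).congr fun a (ha : k * a < m) => ?_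
  have hne : m - k * a ≠ 0 := by linarith
  simp only [offsetValue, Pi.add_apply, smul_eq_mul]
  field_simp
  ring

theorem offsetValue_lt_div (hk : k ∈ Set.Ioo (0 : ℝ) 1) (ha : 0 ≤ a) (hx : 0 < M - c * a)
    (ham : a < m) : offsetValue M c m k a < (M - c * a) / (2 * (m - a)) := by
  have hk1 := hk.2
  have hka : k * a ≤ a := mul_le_of_le_one_left ha hk1.le
  unfold offsetValue
  rw [div_lt_div_iff₀ (by linarith) (by linarith)]
  have hcross : k * (2 - k) * (m - a) < m - k * a := by
    nlinarith [mul_pos (pow_pos (sub_pos.2 hk1) 2) (sub_pos.2 ham),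
      mul_nonneg (sub_nonneg.2 hk1.le) ha]
  linarith [mul_lt_mul_of_pos_left hcross hx]

theorem supportTop_budgetLine_pos (hM : 0 < M) (ha : 0 ≤ a) (hca : c * a ≤ M) :
    0 < supportTop a (M - c * a) := by
  have hU := two_mul_add_le_supportTop ha (sub_nonneg.2 hca)
  rcases ha.eq_or_lt with rfl | ha
  · linarith
  · linarith

theorem le_add_supportTop_of_le (hc : 0 < c) (hcm : c * m ≤ M) (ha : 0 ≤ a) (hab : a ≤ b)
    (hb : c * b ≤ M) (h : m ≤ (a + supportTop a (M - c * a)) / 2) :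
    m ≤ (b + supportTop b (M - c * b)) / 2 := by
  have hbM : b ≤ M / c := by rwa [le_div_iff₀' hc]
  have hM : c * (M / c) = M := mul_div_cancel₀ M hc.ne'
  have htop : supportTop (M / c) (M - c * (M / c)) = M / c := by simp [hM, supportTop]
  have hconc : ConcaveOn ℝ {a | 0 ≤ a ∧ c * a ≤ M} fun a => a + supportTop a (M - c * a) :=
    (concaveOn_id (concaveOn_supportTop_budgetLine c M).1).add
      (concaveOn_supportTop_budgetLine c M)
  have hmin := hconc.min_le_of_mem_Icc (y := M / c) ⟨ha, by nlinarith⟩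
    ⟨ha.trans (hab.trans hbM), hM.le⟩ ⟨hab, hbM⟩
  rw [htop] at hmin
  have hmM : m ≤ M / c := by rwa [le_div_iff₀' hc]
  have := (le_min (show 2 * m ≤ _ by linarith) (show 2 * m ≤ _ by linarith)).trans hmin
  linarith

/-- How much more the committed player gets, in the first regime of `headStartValue`, when the
opponent does not respond than when it offsets. -/
def offsetGap (M c m k a : ℝ) : ℝ := 1 - m / supportTop a (M - c * a) - offsetValue M c m k a

theorem headStartValue_eq_add_offsetGap (h : m ≤ (a + supportTop a (M - c * a)) / 2) :
    headStartValue a (M - c * a) m = offsetValue M c m k a + offsetGap M c m k a := by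
  rw [headStartValue_of_le h, offsetGap]
  ring

theorem concaveOn_offsetGap (hM : 0 < M) (hm : 0 ≤ m) (hk : k ≤ 2) (hcm : c * m ≤ k * M) :
    ConcaveOn ℝ {a | (0 ≤ a ∧ c * a ≤ M) ∧ k * a < m} (offsetGap M c m k) := by
  have hU := concaveOn_supportTop_budgetLine c M
  have hoff := convexOn_offsetValue (M := M) hk hcm
  have hconv := hU.1.inter hoff.1
  have hinv := (convexOn_inv_of_concaveOn hU fun a ha =>
    supportTop_budgetLine_pos hM ha.1 ha.2).smul hm
  exact ((concaveOn_const 1 hconv).sub (hinv.subset Set.inter_subset_left hconv)).sub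
    (hoff.subset Set.inter_subset_right hconv)

theorem continuousOn_offsetGap (hM : 0 < M) :
    ContinuousOn (offsetGap M c m k) {a | (0 ≤ a ∧ c * a ≤ M) ∧ k * a < m} := by
  have hU : Continuous fun a => supportTop a (M - c * a) := by
    unfold supportTop
    fun_prop
  refine ContinuousOn.sub ?_ ?_
  · exact continuousOn_const.sub (continuousOn_const.div hU.continuousOn fun a ha =>
      (supportTop_budgetLine_pos hM ha.1.1 ha.1.2).ne')
  · exact ContinuousOn.div (by fun_prop) (by fun_prop) fun a ha => by linarith [ha.2]

theorem offsetGap_pos_of_eq (hk : k ∈ Set.Ioo (0 : ℝ) 1) (ha : 0 ≤ a) (hx : 0 < M - c * a)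
    (h : a + supportTop a (M - c * a) = 2 * m) : 0 < offsetGap M c m k a := by
  have hU := two_mul_add_le_supportTop ha hx.le
  have hsq := sq_supportTop_sub ha hx.le
  have hm : m = (a + supportTop a (M - c * a)) / 2 := by linarith
  have hregimes : 1 - m / supportTop a (M - c * a) = (M - c * a) / (2 * (m - a)) := by
    have hden : 2 * (m - a) = supportTop a (M - c * a) - a := by linarith
    rw [hden, hm]
    generalize supportTop a (M - c * a) = U at *
    have : U ≠ 0 := by linarith
    have : U - a ≠ 0 := by linarith
    field_simp
    linear_combination hsq
  rw [offsetGap, hregimes]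
  exact sub_pos.2 (offsetValue_lt_div hk ha hx (by linarith))

theorem exists_offsetGap_pos (hM : 0 < M) (hc : 0 ≤ c) (hk : k ∈ Set.Ioo (0 : ℝ) 1)
    (hkM : k * M < m) (ha : 0 ≤ a) (hca : c * a < M)
    (h : m ≤ (a + supportTop a (M - c * a)) / 2) :
    ∃ q, 0 ≤ q ∧ q ≤ a ∧ m ≤ (q + supportTop q (M - c * q)) / 2 ∧ 0 < offsetGap M c m k q := by
  have hU0 : supportTop 0 (M - c * 0) = 2 * M := by simp [supportTop_zero_left hM.le]
  rcases le_or_gt m M with hmM | hmM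
  · have hregime : m ≤ (0 + supportTop 0 (M - c * 0)) / 2 := by linarith
    refine ⟨0, le_rfl, ha, hregime, ?_⟩
    have hpos := div_lt_headStartValue_zero hM hk hkM
    have hgap := headStartValue_eq_add_offsetGap (k := k) hregime
    simp only [offsetValue, mul_zero, sub_zero] at hgap
    linarith
  · have hcont : Continuous fun q => q + supportTop q (M - c * q) := by
      unfold supportTop
      fun_prop
    obtain ⟨q, ⟨hq, hqa⟩, hroot⟩ := intermediate_value_Icc ha hcont.continuousOn
      (show 2 * m ∈ Set.Icc _ _ from ⟨by linarith, by linarith⟩)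
    have hcq : c * q ≤ c * a := by gcongr
    exact ⟨q, hq, hqa, (eq_div_of_mul_eq two_ne_zero (by linarith)).le,
      offsetGap_pos_of_eq hk hq (by linarith) hroot⟩

theorem headStartValue_lt_offsetValue_of_lt (hM : 0 < M) (hc : 0 < c) (hk : k ∈ Set.Ioo (0 : ℝ) 1)
    (hkM : k * M < m) (hcm : c * m ≤ k * M) (ha : 0 ≤ a) (hab : a < b) (hkb : k * b < m)
    (h : headStartValue a (M - c * a) m ≤ offsetValue M c m k a) :
    headStartValue b (M - c * b) m < offsetValue M c m k b := by
  have hm : 0 < m := (mul_pos hk.1 hM).trans hkM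
  have hkM' : k * M < M := mul_lt_of_lt_one_left hM hk.2
  have hb : c * b < M := lt_of_mul_lt_mul_left
    (by linarith [mul_lt_mul_of_pos_left hkb hc] : k * (c * b) < k * M) hk.1.le
  have hcab : c * a < c * b := by gcongr
  have hkab : k * a < k * b := mul_lt_mul_of_pos_left hab hk.1
  have hregime : m ≤ (a + supportTop a (M - c * a)) / 2 := by
    by_contra! hlt
    rw [headStartValue_of_lt hlt] at h
    exact h.not_gt (offsetValue_lt_div hk ha (by linarith)
      (by linarith [two_mul_add_le_supportTop ha (show 0 ≤ M - c * a by linarith)]))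
  obtain ⟨q, hq, hqa, -, hgap⟩ := exists_offsetGap_pos hM hc.le hk hkM ha (by linarith) hregime
  have hgap_a : offsetGap M c m k a ≤ 0 := by
    linarith [headStartValue_eq_add_offsetGap (k := k) hregime]
  have hqa : q < a := hqa.lt_of_ne (by rintro rfl; exact hgap_a.not_gt hgap)
  have hgap_b : offsetGap M c m k b < offsetGap M c m k a :=
    (concaveOn_offsetGap hM hm.le (by linarith [hk.2]) hcm).lt_right_of_left_lt
      ⟨⟨hq, by nlinarith⟩, by nlinarith [hk.1]⟩ ⟨⟨by linarith, hb.le⟩, hkb⟩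
      (by rw [openSegment_eq_Ioo (hqa.trans hab)]; exact ⟨hqa, hab⟩) (hgap_a.trans_lt hgap)
  rw [headStartValue_eq_add_offsetGap (k := k)
    (le_add_supportTop_of_le hc (by linarith) ha hab.le hb.le hregime)]
  linarith

theorem offsetGap_neg_of_sub_eq (hk : k ∈ Set.Ioo (0 : ℝ) 1) (ha : 0 < a) (hx : 0 < M - c * a)
    (h : m - k * a = k * (M - c * a)) (hregime : m ≤ (a + supportTop a (M - c * a)) / 2) :
    offsetGap M c m k a < 0 := by
  have hm : 0 < m := by linarith [mul_pos hk.1 ha, mul_pos hk.1 hx]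
  have hlt := headStartValue_lt_one_sub ha hx hk.1 hk.2.le hm h.le
  have hoff : offsetValue M c m k a = 1 - (m - k * a) / (2 * (M - c * a)) := by
    have := hk.1.ne'
    rw [offsetValue, h]
    field_simp
  linarith [headStartValue_eq_add_offsetGap (k := k) hregime]

theorem exists_headStartValue_eq_offsetValue (hM : 0 < M) (hc : c ∈ Set.Ioo (0 : ℝ) 1)
    (hk : k ∈ Set.Ioo (0 : ℝ) 1) (hkM : k * M < m) (hcm : c * m < k * M) :
    ∃ a, 0 < a ∧ c * a < M ∧ k * (M - c * a) < m - k * a ∧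
      headStartValue a (M - c * a) m = offsetValue M c m k a := by
  obtain ⟨hc0, hc1⟩ := hc
  have hkc : 0 < k * (1 - c) := mul_pos hk.1 (sub_pos.2 hc1)
  set e := (m - k * M) / (k * (1 - c))
  have he : k * (1 - c) * e = m - k * M := mul_div_cancel₀ _ hkc.ne'
  have he0 : 0 < e := div_pos (sub_pos.2 hkM) hkc
  have heM : c * e < M := by
    refine lt_of_mul_lt_mul_left (a := k * (1 - c)) ?_ hkc.le
    calc k * (1 - c) * (c * e) = c * (m - k * M) := by rw [← he]; ring
      _ < k * (1 - c) * M := by linarith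
  have hR : 0 < M - c * e := sub_pos.2 heM
  have hregime : m ≤ (e + supportTop e (M - c * e)) / 2 := by
    have : k * (e + (M - c * e)) ≤ e + (M - c * e) :=
      mul_le_of_le_one_left (by linarith) hk.2.le
    linarith [two_mul_add_le_supportTop he0.le hR.le]
  obtain ⟨q, hq, hqe, hregime_q, hgap_q⟩ :=
    exists_offsetGap_pos hM hc0.le hk hkM he0.le heM hregime
  have hcont : ContinuousOn (offsetGap M c m k) (Set.Icc q e) :=
    (continuousOn_offsetGap hM).mono fun z hz =>
      ⟨⟨hq.trans hz.1, by nlinarith [hz.2]⟩, by nlinarith [hz.2, hk.1, mul_pos hk.1 hR]⟩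
  obtain ⟨a, ⟨hqa, hae⟩, hroot⟩ := intermediate_value_Ioo' hqe hcont
    ⟨offsetGap_neg_of_sub_eq hk he0 hR (by linarith) hregime, hgap_q⟩
  have hcae : c * a < c * e := by gcongr
  have hkae : k * (1 - c) * a < k * (1 - c) * e := by gcongr
  refine ⟨a, hq.trans_lt hqa, hcae.trans heM, by linarith, ?_⟩
  rw [headStartValue_eq_add_offsetGap (le_add_supportTop_of_le hc0
    (by linarith [mul_lt_of_lt_one_left hM hk.2]) hq hqa.le (by linarith) hregime_q), hroot,
    add_zero]

end offset

section response

variable {MA cA MB cB a b : ℝ}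

theorem uA_of_le (ha : cA * a ≤ MA) (hb : cB * b ≤ MB) (hba : b ≤ a) :
    uA MA cA MB cB a b = headStartValue (a - b) (MA - cA * a) (MB - cB * b) :=
  eqPayoffA_of_nonneg (sub_nonneg.2 hba) (sub_nonneg.2 ha) (sub_nonneg.2 hb)

theorem uA_of_lt (ha : cA * a ≤ MA) (hb : cB * b ≤ MB) (hab : a < b) :
    uA MA cA MB cB a b = 1 - headStartValue (b - a) (MB - cB * b) (MA - cA * a) := by
  rw [uA, eqPayoffA_of_neg (sub_neg.2 hab) (sub_nonneg.2 ha) (sub_nonneg.2 hb), neg_sub]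

theorem uA_zero_right (ha0 : 0 ≤ a) (ha : cA * a ≤ MA) (hMB : 0 ≤ MB) :
    uA MA cA MB cB a 0 = headStartValue a (MA - cA * a) MB := by
  rw [uA_of_le ha (by rwa [mul_zero]) ha0, sub_zero, mul_zero, sub_zero]

theorem uA_nonneg (a b : ℝ) : 0 ≤ uA MA cA MB cB a b :=
  Real.iSup_nonneg fun FA => Real.iInf_nonneg fun FB => payoffA_nonneg _ FA FB

theorem pHat_eq_add_pBar (hcB : cB ∈ Set.Ioo (0 : ℝ) 1) (a : ℝ) :
    pHat MB cB a = a + pBar (MB - cB * a) cB := by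
  have h0 : cB ≠ 0 := hcB.1.ne'
  have h2 : 2 - cB ≠ 0 := by linarith [hcB.2]
  unfold pHat pBar
  field_simp
  ring

theorem lt_pHat (hcB : cB ∈ Set.Ioo (0 : ℝ) 1) (ha : cB * a < MB) : a < pHat MB cB a := by
  rw [pHat_eq_add_pBar hcB]
  linarith [pBar_pos (sub_pos.2 ha) hcB]

theorem mul_pHat_le_iff (hcB : cB ∈ Set.Ioo (0 : ℝ) 1) :
    cB * pHat MB cB a ≤ MB ↔ cB * a ≤ MB := by
  have h2 : 0 < 2 - cB := by linarith [hcB.2]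
  have hmul : cB * pHat MB cB a = MB - cB / (2 - cB) * (MB - cB * a) := by
    have h0 : cB ≠ 0 := hcB.1.ne'
    unfold pHat
    field_simp
  rw [hmul, sub_le_self_iff, mul_nonneg_iff_of_pos_left (div_pos hcB.1 h2), sub_nonneg]

theorem uA_pHat (hcB : cB ∈ Set.Ioo (0 : ℝ) 1) (ha : cA * a ≤ MA) (hab : cB * a < MB)
    (h : cB * (MA - cA * a) ≤ MB - cB * a) :
    uA MA cA MB cB a (pHat MB cB a) = offsetValue MA cA MB cB a := by
  rw [uA_of_lt ha ((mul_pHat_le_iff hcB).2 hab.le) (lt_pHat hcB hab), pHat_eq_add_pBar hcB,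
    add_sub_cancel_left, mul_add, ← sub_sub, headStartValue_pBar (sub_pos.2 hab) hcB h,
    sub_sub_cancel, div_div_eq_mul_div, offsetValue]

theorem uA_zero_lt_of_weak (hMB : 0 < MB) (hcB : cB ∈ Set.Ioo (0 : ℝ) 1) (ha0 : 0 < a)
    (ha : cA * a < MA) (h : MB - cB * a ≤ cB * (MA - cA * a)) (hb0 : 0 < b) (hb : cB * b ≤ MB) :
    uA MA cA MB cB a 0 < uA MA cA MB cB a b := by
  have hR : 0 < MA - cA * a := sub_pos.2 ha
  have hcR : cB * (MA - cA * a) ≤ MA - cA * a := mul_le_of_le_one_left hR.le hcB.2.le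
  have hlt := headStartValue_lt_one_sub ha0 hR hcB.1 hcB.2.le hMB h
  rw [uA_zero_right ha0.le ha.le hMB.le]
  rcases le_or_gt b a with hba | hba
  · rw [uA_of_le ha.le hb hba]
    have hresp := headStartValue_lt_or_headStartValue_zero_le (n := MB - cB * a) hR hcB.1.le
      (sub_nonneg.2 hba) (sub_lt_self a hb0) (by linarith)
    rw [sub_add_cancel, show MB - cB * a + cB * (a - b) = MB - cB * b by ring] at hresp
    refine hresp.elim id fun ⟨_, hzero⟩ => hlt.trans_le ?_
    rwa [headStartValue_zero_of_le hR.le (h.trans hcR)] at hzero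
  · rw [uA_of_lt ha.le hb hba]
    have hcap := headStartValue_le_of_weak (sub_nonneg.2 hba.le) (sub_nonneg.2 hb) hcB.1 hR
      (show MB - cB * b + cB * (b - a) ≤ _ by linarith)
    rw [show MB - cB * b + cB * (b - a) = MB - cB * a by ring] at hcap
    linarith

theorem min_lt_uA_of_strong (hcB : cB ∈ Set.Ioo (0 : ℝ) 1) (ha0 : 0 ≤ a) (ha : cA * a < MA)
    (h : cB * (MA - cA * a) < MB - cB * a) (hb0 : 0 < b) (hb : cB * b ≤ MB)
    (hne : b ≠ pHat MB cB a) :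
    min (uA MA cA MB cB a 0) (offsetValue MA cA MB cB a) < uA MA cA MB cB a b := by
  have hR : 0 < MA - cA * a := sub_pos.2 ha
  have hn : 0 < MB - cB * a := (mul_pos hcB.1 hR).trans h
  rcases le_or_gt b a with hba | hba
  · rw [uA_of_le ha.le hb hba,
      uA_zero_right ha0 ha.le (by linarith [mul_nonneg hcB.1.le ha0])]
    have hresp := headStartValue_lt_or_headStartValue_zero_le (n := MB - cB * a) hR hcB.1.le
      (sub_nonneg.2 hba) (sub_lt_self a hb0) (by linarith)
    rw [sub_add_cancel, show MB - cB * a + cB * (a - b) = MB - cB * b by ring] at hresp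
    exact hresp.elim (min_le_left _ _).trans_lt fun ⟨_, hzero⟩ =>
      (min_le_right _ _).trans_lt ((div_lt_headStartValue_zero hR hcB h).trans_le hzero)
  · rw [uA_of_lt ha.le hb hba]
    have hopt := headStartValue_lt_of_ne_pBar (p := b - a) (x := MB - cB * b) hn hcB
      (sub_nonneg.2 hba.le) (sub_nonneg.2 hb) (by linarith) hR h fun hpBar =>
        hne (by rw [pHat_eq_add_pBar hcB, ← hpBar.1, add_sub_cancel])
    rw [headStartValue_pBar hn hcB h.le, div_div_eq_mul_div] at hopt
    exact (min_le_right _ _).trans_lt (lt_sub_comm.1 hopt)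

theorem offsetValue_zero_lt_uA_zero (hMA : 0 < MA) (hcB : cB ∈ Set.Ioo (0 : ℝ) 1)
    (h : cB * MA < MB) : offsetValue MA cA MB cB 0 < uA MA cA MB cB 0 0 := by
  have hMB : 0 < MB := (mul_pos hcB.1 hMA).trans h
  rw [uA_zero_right le_rfl (by simpa using hMA.le) hMB.le]
  simpa [offsetValue] using div_lt_headStartValue_zero hMA hcB h

theorem mem_Icc_div_iff {M c q : ℝ} (hc : 0 < c) :
    q ∈ Set.Icc 0 (M / c) ↔ 0 ≤ q ∧ c * q ≤ M := by
  rw [Set.mem_Icc, le_div_iff₀' hc]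

/-- `b` is a best response of player `B` to the pre-allocation `a`. -/
def IsBestResponse (MA cA MB cB a b : ℝ) : Prop :=
  b ∈ Set.Icc 0 (MB / cB) ∧ IsMinOn (fun q => uA MA cA MB cB a q) (Set.Icc 0 (MB / cB)) b

theorem isBestResponse_iff_of_weak (hMB : 0 < MB) (hcB : cB ∈ Set.Ioo (0 : ℝ) 1) (ha0 : 0 < a)
    (ha : cA * a < MA) (h : MB - cB * a ≤ cB * (MA - cA * a)) (b : ℝ) :
    IsBestResponse MA cA MB cB a b ↔ b = 0 := by
  have h0 : (0 : ℝ) ∈ Set.Icc 0 (MB / cB) := ⟨le_rfl, (div_pos hMB hcB.1).le⟩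
  constructor
  · rintro ⟨hb, hmin⟩
    by_contra hne
    obtain ⟨hb0, hb⟩ := (mem_Icc_div_iff hcB.1).1 hb
    exact (hmin h0).not_gt (uA_zero_lt_of_weak hMB hcB ha0 ha h (hb0.lt_of_ne' hne) hb)
  · rintro rfl
    refine ⟨h0, fun q hq => ?_⟩
    obtain ⟨hq0, hq⟩ := (mem_Icc_div_iff hcB.1).1 hq
    rcases hq0.eq_or_lt with rfl | hq0
    · exact le_refl (uA MA cA MB cB a 0)
    · exact (uA_zero_lt_of_weak hMB hcB ha0 ha h hq0 hq).le

theorem mul_lt_of_strong (hcB : 0 ≤ cB) (ha : cA * a ≤ MA)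
    (h : cB * (MA - cA * a) < MB - cB * a) : cB * a < MB :=
  sub_pos.1 ((mul_nonneg hcB (sub_nonneg.2 ha)).trans_lt h)

theorem pHat_mem_Icc (hcB : cB ∈ Set.Ioo (0 : ℝ) 1) (ha0 : 0 ≤ a) (ha : cB * a < MB) :
    pHat MB cB a ∈ Set.Icc 0 (MB / cB) :=
  (mem_Icc_div_iff hcB.1).2 ⟨ha0.trans (lt_pHat hcB ha).le, (mul_pHat_le_iff hcB).2 ha.le⟩

theorem isBestResponse_iff_of_strong (hcB : cB ∈ Set.Ioo (0 : ℝ) 1) (ha0 : 0 ≤ a)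
    (ha : cA * a < MA) (h : cB * (MA - cA * a) < MB - cB * a) (b : ℝ) :
    IsBestResponse MA cA MB cB a b ↔
      b = 0 ∧ uA MA cA MB cB a 0 ≤ offsetValue MA cA MB cB a ∨
      b = pHat MB cB a ∧ offsetValue MA cA MB cB a ≤ uA MA cA MB cB a 0 := by
  have hn := mul_lt_of_strong hcB.1.le ha.le h
  have hMB : 0 < MB := (mul_nonneg hcB.1.le ha0).trans_lt hn
  have h0 : (0 : ℝ) ∈ Set.Icc 0 (MB / cB) := ⟨le_rfl, (div_pos hMB hcB.1).le⟩
  have hp := pHat_mem_Icc hcB ha0 hn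
  have hup := uA_pHat hcB ha.le hn h.le
  have hlt {q : ℝ} (hq : q ∈ Set.Icc 0 (MB / cB)) (hq0 : q ≠ 0) (hqp : q ≠ pHat MB cB a) :
      min (uA MA cA MB cB a 0) (offsetValue MA cA MB cB a) < uA MA cA MB cB a q :=
    min_lt_uA_of_strong hcB ha0 ha h (hq.1.lt_of_ne' hq0) ((mem_Icc_div_iff hcB.1).1 hq).2 hqp
  have hmin : ∀ q ∈ Set.Icc 0 (MB / cB),
      min (uA MA cA MB cB a 0) (offsetValue MA cA MB cB a) ≤ uA MA cA MB cB a q := by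
    intro q hq
    rcases eq_or_ne q 0 with rfl | hq0
    · exact min_le_left _ _
    rcases eq_or_ne q (pHat MB cB a) with rfl | hqp
    · exact hup ▸ min_le_right _ _
    · exact (hlt hq hq0 hqp).le
  constructor
  · rintro ⟨hb, hbmin⟩
    have hb_zero : uA MA cA MB cB a b ≤ uA MA cA MB cB a 0 := hbmin h0
    have hb_pHat : uA MA cA MB cB a b ≤ offsetValue MA cA MB cB a := hup ▸ hbmin hp
    rcases eq_or_ne b 0 with rfl | hb0
    · exact Or.inl ⟨rfl, hb_pHat⟩
    rcases eq_or_ne b (pHat MB cB a) with rfl | hbp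
    · exact Or.inr ⟨rfl, hup ▸ hb_zero⟩
    · exact absurd (le_min hb_zero hb_pHat) (hlt hb hb0 hbp).not_ge
  · rintro (⟨rfl, hle⟩ | ⟨rfl, hle⟩)
    · exact ⟨h0, fun q hq => (min_eq_left hle).ge.trans (hmin q hq)⟩
    · exact ⟨hp, fun q hq => hup.le.trans ((min_eq_right hle).ge.trans (hmin q hq))⟩

/-- The payoff that player `A` secures with the pre-allocation `a` against every response. -/
def securedValue (MA cA MB cB a : ℝ) : ℝ := sInf (uA MA cA MB cB a '' Set.Icc 0 (MB / cB))

theorem securedValue_le (hb : b ∈ Set.Icc 0 (MB / cB)) :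
    securedValue MA cA MB cB a ≤ uA MA cA MB cB a b :=
  csInf_le ⟨0, by rintro _ ⟨q, -, rfl⟩; exact uA_nonneg a q⟩ ⟨b, hb, rfl⟩

theorem securedValue_le_uA_zero (hMB : 0 ≤ MB) (hcB : 0 ≤ cB) (a : ℝ) :
    securedValue MA cA MB cB a ≤ uA MA cA MB cB a 0 :=
  securedValue_le ⟨le_rfl, div_nonneg hMB hcB⟩

theorem securedValue_le_offsetValue (hcB : cB ∈ Set.Ioo (0 : ℝ) 1) (ha0 : 0 ≤ a)
    (ha : cA * a ≤ MA) (h : cB * (MA - cA * a) < MB - cB * a) :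
    securedValue MA cA MB cB a ≤ offsetValue MA cA MB cB a := by
  have hn := mul_lt_of_strong hcB.1.le ha h
  rw [← uA_pHat hcB ha hn h.le]
  exact securedValue_le (pHat_mem_Icc hcB ha0 hn)

theorem IsBestResponse.securedValue_eq (h : IsBestResponse MA cA MB cB a b) :
    securedValue MA cA MB cB a = uA MA cA MB cB a b :=
  IsLeast.csInf_eq ⟨⟨b, h.1, rfl⟩, by rintro _ ⟨q, hq, rfl⟩; exact h.2 hq⟩

end response

section indifference

variable {MA cA MB cB a b : ℝ}

theorem uA_zero_lt_uA_pHat_of_eq (hMB : 0 < MB) (hcB : cB ∈ Set.Ioo (0 : ℝ) 1) (ha0 : 0 ≤ a)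
    (ha : cA * a = MA) (hb : cB * a = MB) :
    uA MA cA MB cB a 0 < uA MA cA MB cB a (pHat MB cB a) := by
  have hpHat : pHat MB cB a = a := by simp [pHat_eq_add_pBar hcB, hb, pBar]
  have htie : uA MA cA MB cB a a = 1 := by
    rw [uA, ha, hb, sub_self, sub_self, sub_self, eqPayoffA_zero]
  rw [hpHat, htie, uA_zero_right ha0 ha.le hMB.le]
  exact headStartValue_lt_one ha0 (sub_nonneg.2 ha.le) hMB

theorem isIndifference_iff (hMB : 0 < MB) (hcA : 0 < cA) (hcB : cB ∈ Set.Ioo (0 : ℝ) 1)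
    (h : cA * MB ≤ cB * MA) : IsIndifference MA cA MB cB a ↔
      0 < a ∧ cA * a < MA ∧ cB * (MA - cA * a) < MB - cB * a ∧
        uA MA cA MB cB a 0 = offsetValue MA cA MB cB a := by
  rw [IsIndifference, uB, uB, sub_right_inj, Set.mem_Ioc, le_div_iff₀' hcA]
  constructor
  · rintro ⟨⟨ha0, ha⟩, hp, heq⟩
    have hb : cB * a ≤ MB := (mul_pHat_le_iff hcB).1 ((mem_Icc_div_iff hcB.1).1 hp).2
    rcases ha.eq_or_lt with ha | ha
    · refine absurd heq (uA_zero_lt_uA_pHat_of_eq hMB hcB ha0.le ha (hb.antisymm ?_)).ne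
      exact le_of_mul_le_mul_left (by rwa [mul_left_comm, ha]) hcA
    have hp0 : 0 < pHat MB cB a := by
      rcases hb.eq_or_lt with hb | hb
      · simpa [pHat_eq_add_pBar hcB, hb, pBar] using ha0
      · exact ha0.trans (lt_pHat hcB hb)
    have hst : cB * (MA - cA * a) < MB - cB * a := by
      by_contra! hweak
      exact (uA_zero_lt_of_weak hMB hcB ha0 ha hweak hp0 ((mul_pHat_le_iff hcB).2 hb)).ne heq
    exact ⟨ha0, ha, hst,
      heq.trans (uA_pHat hcB ha.le (mul_lt_of_strong hcB.1.le ha.le hst) hst.le)⟩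
  · rintro ⟨ha0, ha, hst, heq⟩
    have hn := mul_lt_of_strong hcB.1.le ha.le hst
    exact ⟨⟨ha0, ha.le⟩, pHat_mem_Icc hcB ha0.le hn, heq.trans (uA_pHat hcB ha.le hn hst.le).symm⟩

theorem uA_zero_lt_offsetValue_of_lt (hMA : 0 < MA) (hcA : 0 < cA)
    (hcB : cB ∈ Set.Ioo (0 : ℝ) 1) (h₁ : cB * MA < MB) (h₂ : cA * MB ≤ cB * MA) (ha : 0 ≤ a)
    (hab : a < b) (hbA : cA * b ≤ MA) (hbB : cB * b < MB)
    (h : uA MA cA MB cB a 0 ≤ offsetValue MA cA MB cB a) :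
    uA MA cA MB cB b 0 < offsetValue MA cA MB cB b := by
  have hMB : 0 < MB := (mul_pos hcB.1 hMA).trans h₁
  have hcab : cA * a < cA * b := mul_lt_mul_of_pos_left hab hcA
  rw [uA_zero_right ha (hcab.le.trans hbA) hMB.le] at h
  rw [uA_zero_right (ha.trans hab.le) hbA hMB.le]
  exact headStartValue_lt_offsetValue_of_lt hMA hcA hcB h₁ h₂ ha hab hbB h

theorem IsIndifference.le (hMA : 0 < MA) (hcA : 0 < cA) (hcB : cB ∈ Set.Ioo (0 : ℝ) 1)
    (h₁ : cB * MA < MB) (h₂ : cA * MB ≤ cB * MA) (ha : IsIndifference MA cA MB cB a)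
    (hb : IsIndifference MA cA MB cB b) : b ≤ a := by
  have hMB : 0 < MB := (mul_pos hcB.1 hMA).trans h₁
  obtain ⟨ha0, -, -, ha_eq⟩ := (isIndifference_iff hMB hcA hcB h₂).1 ha
  obtain ⟨-, hb, hb_st, hb_eq⟩ := (isIndifference_iff hMB hcA hcB h₂).1 hb
  by_contra! hab
  exact (uA_zero_lt_offsetValue_of_lt hMA hcA hcB h₁ h₂ ha0.le hab hb.le
    (mul_lt_of_strong hcB.1.le hb.le hb_st) ha_eq.le).ne hb_eq

theorem IsIndifference.eq (hMA : 0 < MA) (hcA : 0 < cA) (hcB : cB ∈ Set.Ioo (0 : ℝ) 1)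
    (h₁ : cB * MA < MB) (h₂ : cA * MB ≤ cB * MA) (ha : IsIndifference MA cA MB cB a)
    (hb : IsIndifference MA cA MB cB b) : a = b :=
  (hb.le hMA hcA hcB h₁ h₂ ha).antisymm (ha.le hMA hcA hcB h₁ h₂ hb)

theorem exists_isIndifference (hMA : 0 < MA) (hcA : cA ∈ Set.Ioo (0 : ℝ) 1)
    (hcB : cB ∈ Set.Ioo (0 : ℝ) 1) (h₁ : cB * MA < MB) (h₂ : cA * MB < cB * MA) :
    ∃ a, IsIndifference MA cA MB cB a := by
  have hMB : 0 < MB := (mul_pos hcB.1 hMA).trans h₁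
  obtain ⟨a, ha0, ha, hst, heq⟩ := exists_headStartValue_eq_offsetValue hMA hcA hcB h₁ h₂
  refine ⟨a, (isIndifference_iff hMB hcA.1 hcB h₂.le).2 ⟨ha0, ha, hst, ?_⟩⟩
  rw [uA_zero_right ha0.le ha.le hMB.le, heq]

theorem IsIndifference.isBestResponse_iff (hMB : 0 < MB) (hcA : 0 < cA)
    (hcB : cB ∈ Set.Ioo (0 : ℝ) 1) (h : cA * MB ≤ cB * MA) (ha : IsIndifference MA cA MB cB a)
    (b : ℝ) : IsBestResponse MA cA MB cB a b ↔ b = 0 ∨ b = pHat MB cB a := by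
  obtain ⟨ha0, ha, hst, heq⟩ := (isIndifference_iff hMB hcA hcB h).1 ha
  simp only [isBestResponse_iff_of_strong hcB ha0.le ha hst, heq, le_refl, and_true]

end indifference

section equilibria

variable {MA cA MB cB a : ℝ}

theorem isOptimalInvestment_iff (hMA : 0 < MA) (hMB : 0 < MB) (hcA : cA ∈ Set.Ioo (0 : ℝ) 1)
    (h : cA * MB < MA) (P R : ℝ) : IsOptimalInvestment MA cA MB P R ↔
      P = pBar MA cA ∧ R = MA - cA * pBar MA cA := by
  have hp := pBar_pos hMA hcA
  have hr := sub_pos.2 (mul_pBar_lt hMA hcA)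
  have hlt {P R : ℝ} (hP : 0 ≤ P) (hR : 0 ≤ R) (hPR : R + cA * P ≤ MA)
      (hne : ¬(P = pBar MA cA ∧ R = MA - cA * pBar MA cA)) :
      eqPayoffA P R MB < eqPayoffA (pBar MA cA) (MA - cA * pBar MA cA) MB := by
    rw [eqPayoffA_of_nonneg hP hR hMB.le, eqPayoffA_of_nonneg hp.le hr.le hMB.le]
    exact headStartValue_lt_of_ne_pBar hMA hcA hP hR hPR hMB h hne
  constructor
  · rintro ⟨⟨hP, hR, hPR⟩, hopt⟩
    by_contra hne
    exact (hopt _ _ hp.le hr.le (by linarith)).not_gt (hlt hP hR hPR hne)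
  · rintro ⟨rfl, rfl⟩
    refine ⟨⟨hp.le, hr.le, by linarith⟩, fun P' R' hP hR hPR => ?_⟩
    by_cases heq : P' = pBar MA cA ∧ R' = MA - cA * pBar MA cA
    · rw [heq.1, heq.2]
    · exact (hlt hP hR hPR heq).le

theorem uA_zero_lt_pBar (hMA : 0 < MA) (hMB : 0 < MB) (hcA : cA ∈ Set.Ioo (0 : ℝ) 1)
    (h : cA * MB < MA) (ha0 : 0 ≤ a) (ha : cA * a ≤ MA) (hne : a ≠ pBar MA cA) :
    uA MA cA MB cB a 0 < uA MA cA MB cB (pBar MA cA) 0 := by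
  rw [uA_zero_right ha0 ha hMB.le,
    uA_zero_right (pBar_pos hMA hcA).le (mul_pBar_lt hMA hcA).le hMB.le]
  exact headStartValue_lt_of_ne_pBar hMA hcA ha0 (sub_nonneg.2 ha) (by linarith) hMB h
    fun heq => hne heq.1

theorem uA_zero_lt_of_pBar_le {b : ℝ} (hMA : 0 < MA) (hMB : 0 < MB)
    (hcA : cA ∈ Set.Ioo (0 : ℝ) 1) (h : cA * MB < MA) (ha : pBar MA cA ≤ a) (hab : a < b)
    (hb : cA * b ≤ MA) : uA MA cA MB cB b 0 < uA MA cA MB cB a 0 := by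
  have ha0 := (pBar_pos hMA hcA).le.trans ha
  have hcab := mul_lt_mul_of_pos_left hab hcA.1
  rw [uA_zero_right (ha0.trans hab.le) hb hMB.le, uA_zero_right ha0 (hcab.le.trans hb) hMB.le]
  exact headStartValue_lt_of_pBar_le hMA hcA hMB h ha hab hb

theorem isStackelberg_iff_of_forall_lt (hcA : 0 < cA) (ha : a ∈ Set.Icc 0 (MA / cA))
    (h : ∀ q, 0 ≤ q → cA * q ≤ MA → q ≠ a →
      securedValue MA cA MB cB q < securedValue MA cA MB cB a) (pA pB : ℝ) :
    IsStackelberg MA cA MB cB pA pB ↔ pA = a ∧ IsBestResponse MA cA MB cB a pB := by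
  have hlt {q : ℝ} (hq : q ∈ Set.Icc 0 (MA / cA)) (hne : q ≠ a) :
      securedValue MA cA MB cB q < securedValue MA cA MB cB a :=
    h q hq.1 ((mem_Icc_div_iff hcA).1 hq).2 hne
  constructor
  · rintro ⟨⟨hpA, hmax⟩, hresp⟩
    obtain rfl : pA = a := by
      by_contra hne
      exact (hmax ha).not_gt (hlt hpA hne)
    exact ⟨rfl, hresp⟩
  · rintro ⟨rfl, hresp⟩
    refine ⟨⟨ha, fun q hq => ?_⟩, hresp⟩
    rcases eq_or_ne q pA with rfl | hne
    · exact le_refl (securedValue MA cA MB cB q)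
    · exact (hlt hq hne).le

theorem isStackelberg_iff_pBar (hMA : 0 < MA) (hMB : 0 < MB) (hcA : cA ∈ Set.Ioo (0 : ℝ) 1)
    (hcB : 0 ≤ cB) (h : cA * MB < MA)
    (hresp : ∀ b, IsBestResponse MA cA MB cB (pBar MA cA) b ↔ b = 0) (pA pB : ℝ) :
    IsStackelberg MA cA MB cB pA pB ↔ pA = pBar MA cA ∧ pB = 0 := by
  rw [← hresp]
  refine isStackelberg_iff_of_forall_lt hcA.1 ((mem_Icc_div_iff hcA.1).2
    ⟨(pBar_pos hMA hcA).le, (mul_pBar_lt hMA hcA).le⟩) (fun q hq0 hq hne => ?_) pA pB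
  rw [((hresp 0).2 rfl).securedValue_eq]
  exact (securedValue_le_uA_zero hMB.le hcB q).trans_lt (uA_zero_lt_pBar hMA hMB hcA h hq0 hq hne)

theorem isStackelberg_iff_of_weak (hMA : 0 < MA) (hMB : 0 < MB) (hcA : cA ∈ Set.Ioo (0 : ℝ) 1)
    (hcB : cB ∈ Set.Ioo (0 : ℝ) 1) (h : MB ≤ cB * MA) (pA pB : ℝ) :
    IsStackelberg MA cA MB cB pA pB ↔ pA = pBar MA cA ∧ pB = 0 := by
  have hp := pBar_pos hMA hcA
  have hweak : MB - cB * pBar MA cA ≤ cB * (MA - cA * pBar MA cA) := by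
    have : 0 ≤ cB * (1 - cA) * pBar MA cA :=
      mul_nonneg (mul_nonneg hcB.1.le (sub_nonneg.2 hcA.2.le)) hp.le
    linarith
  exact isStackelberg_iff_pBar hMA hMB hcA hcB.1.le
    (by linarith [mul_lt_of_lt_one_left hMB hcA.2, mul_lt_of_lt_one_left hMA hcB.2])
    (isBestResponse_iff_of_weak hMB hcB hp (mul_pBar_lt hMA hcA) hweak) pA pB

theorem isStackelberg_iff_of_isIndifference_lt_pBar (hMA : 0 < MA)
    (hcA : cA ∈ Set.Ioo (0 : ℝ) 1) (hcB : cB ∈ Set.Ioo (0 : ℝ) 1) (h₁ : cB * MA < MB)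
    (h₂ : cA * MB ≤ cB * MA) (ha : IsIndifference MA cA MB cB a) (hlt : a < pBar MA cA)
    (pA pB : ℝ) : IsStackelberg MA cA MB cB pA pB ↔ pA = pBar MA cA ∧ pB = 0 := by
  have hMB : 0 < MB := (mul_pos hcB.1 hMA).trans h₁
  obtain ⟨ha0, -, -, heq⟩ := (isIndifference_iff hMB hcA.1 hcB h₂).1 ha
  have hp := pBar_pos hMA hcA
  have hpM := mul_pBar_lt hMA hcA
  refine isStackelberg_iff_pBar hMA hMB hcA hcB.1.le
    (h₂.trans_lt (mul_lt_of_lt_one_left hMA hcB.2)) (fun b => ?_) pA pB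
  rcases le_or_gt (MB - cB * pBar MA cA) (cB * (MA - cA * pBar MA cA)) with h | h
  · exact isBestResponse_iff_of_weak hMB hcB hp hpM h b
  · have hno := uA_zero_lt_offsetValue_of_lt hMA hcA.1 hcB h₁ h₂ ha0.le hlt hpM.le
      (mul_lt_of_strong hcB.1.le hpM.le h) heq.le
    simp only [isBestResponse_iff_of_strong hcB hp.le hpM h, hno.le, hno.not_ge, and_true,
      and_false, or_false]

theorem isStackelberg_iff_of_pBar_le_isIndifference (hMA : 0 < MA) (hMB : 0 < MB)
    (hcA : cA ∈ Set.Ioo (0 : ℝ) 1) (hcB : cB ∈ Set.Ioo (0 : ℝ) 1) (h : cA * MB < cB * MA)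
    (ha : IsIndifference MA cA MB cB a) (hle : pBar MA cA ≤ a) (pA pB : ℝ) :
    IsStackelberg MA cA MB cB pA pB ↔ pA = a ∧ (pB = 0 ∨ pB = pHat MB cB a) := by
  have hresp := ha.isBestResponse_iff hMB hcA.1 hcB h.le
  obtain ⟨ha0, haM, hst, heq⟩ := (isIndifference_iff hMB hcA.1 hcB h.le).1 ha
  rw [← hresp]
  refine isStackelberg_iff_of_forall_lt hcA.1 ((mem_Icc_div_iff hcA.1).2 ⟨ha0.le, haM.le⟩)
    (fun q hq0 hq hne => ?_) pA pB
  rw [((hresp 0).2 (Or.inl rfl)).securedValue_eq]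
  rcases lt_or_gt_of_ne hne with hqa | haq
  · have hq_st : cB * (MA - cA * q) < MB - cB * q := by
      have : cB * (1 - cA) * q < cB * (1 - cA) * a :=
        mul_lt_mul_of_pos_left hqa (mul_pos hcB.1 (sub_pos.2 hcA.2))
      linarith
    refine (securedValue_le_offsetValue hcB hq0 hq hq_st).trans_lt ?_
    rw [heq, offsetValue_lt_iff hcB (mul_lt_of_strong hcB.1.le hq hq_st)
      (mul_lt_of_strong hcB.1.le haM.le hst)]
    exact mul_pos (sub_pos.2 hqa) (sub_pos.2 h)
  · exact (securedValue_le_uA_zero hMB.le hcB.1.le q).trans_lt (uA_zero_lt_of_pBar_le hMA hMB hcA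
      (h.trans (mul_lt_of_lt_one_left hMA hcB.2)) hle haq hq)

theorem strong_of_mul_eq (hcA : cA ∈ Set.Ioo (0 : ℝ) 1) (hcB : 0 < cB) (h : cA * MB = cB * MA)
    (ha : cA * a < MA) : cB * (MA - cA * a) < MB - cB * a := by
  refine lt_of_mul_lt_mul_left ?_ hcA.1.le
  calc cA * (cB * (MA - cA * a)) < cB * (MA - cA * a) :=
        mul_lt_of_lt_one_left (mul_pos hcB (sub_pos.2 ha)) hcA.2
    _ = cA * (MB - cB * a) := by linear_combination -h

theorem offsetValue_le_of_mul_eq {b : ℝ} (hcA : cA ∈ Set.Ioo (0 : ℝ) 1)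
    (hcB : cB ∈ Set.Ioo (0 : ℝ) 1) (h : cA * MB = cB * MA) (ha : cA * a < MA) (hb : cA * b < MA) :
    offsetValue MA cA MB cB a ≤ offsetValue MA cA MB cB b := by
  have hn {q : ℝ} (hq : cA * q < MA) : cB * q < MB :=
    mul_lt_of_strong hcB.1.le hq.le (strong_of_mul_eq hcA hcB.1 h hq)
  rw [offsetValue_le_iff hcB (hn ha) (hn hb), h, sub_self, mul_zero]

theorem IsIndifference.pBar_le_of_mul_eq (hMA : 0 < MA) (hMB : 0 < MB)
    (hcA : cA ∈ Set.Ioo (0 : ℝ) 1) (hcB : cB ∈ Set.Ioo (0 : ℝ) 1) (h : cA * MB = cB * MA)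
    (ha : IsIndifference MA cA MB cB a) : pBar MA cA ≤ a := by
  obtain ⟨ha0, haM, -, heq⟩ := (isIndifference_iff hMB hcA.1 hcB h.le).1 ha
  have hpM := mul_pBar_lt hMA hcA
  by_contra! hlt
  have hopt := uA_zero_lt_pBar (cB := cB) hMA hMB hcA
    (h.trans_lt (mul_lt_of_lt_one_left hMA hcB.2)) ha0.le haM.le hlt.ne
  have hoff := uA_zero_lt_offsetValue_of_lt hMA hcA.1 hcB
    (h.ge.trans_lt (mul_lt_of_lt_one_left hMB hcA.2)) h.le ha0.le hlt hpM.le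
    (mul_lt_of_strong hcB.1.le hpM.le (strong_of_mul_eq hcA hcB.1 h hpM)) heq.le
  linarith [offsetValue_le_of_mul_eq hcA hcB h hpM haM]

theorem IsIndifference.isStackelberg_of_mul_eq {b : ℝ} (hMA : 0 < MA) (hMB : 0 < MB)
    (hcA : cA ∈ Set.Ioo (0 : ℝ) 1) (hcB : cB ∈ Set.Ioo (0 : ℝ) 1) (h : cA * MB = cB * MA)
    (ha : IsIndifference MA cA MB cB a) (hb : b = 0 ∨ b = pHat MB cB a) :
    IsStackelberg MA cA MB cB a b := by
  have hresp := ha.isBestResponse_iff hMB hcA.1 hcB h.le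
  obtain ⟨ha0, haM, -, heq⟩ := (isIndifference_iff hMB hcA.1 hcB h.le).1 ha
  refine ⟨⟨(mem_Icc_div_iff hcA.1).2 ⟨ha0.le, haM.le⟩, fun q hq => ?_⟩, (hresp b).2 hb⟩
  change securedValue MA cA MB cB q ≤ securedValue MA cA MB cB a
  rw [((hresp 0).2 (Or.inl rfl)).securedValue_eq]
  obtain ⟨hq0, hq⟩ := (mem_Icc_div_iff hcA.1).1 hq
  rcases hq.lt_or_eq with hqM | hqM
  · rw [heq]
    exact (securedValue_le_offsetValue hcB hq0 hq (strong_of_mul_eq hcA hcB.1 h hqM)).trans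
      (offsetValue_le_of_mul_eq hcA hcB h hqM haM)
  · have haq : a < q := lt_of_mul_lt_mul_left (by rwa [hqM]) hcA.1.le
    exact (securedValue_le_uA_zero hMB.le hcB.1.le q).trans (uA_zero_lt_of_pBar_le hMA hMB hcA
      (h.trans_lt (mul_lt_of_lt_one_left hMA hcB.2))
      (ha.pBar_le_of_mul_eq hMA hMB hcA hcB h) haq hq).le

theorem isStackelberg_iff_of_strong (hMA : 0 < MA) (hMB : 0 < MB)
    (hcA : cA ∈ Set.Ioo (0 : ℝ) 1) (hcB : cB ∈ Set.Ioo (0 : ℝ) 1) (h : cB * MA < cA * MB)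
    (pA pB : ℝ) : IsStackelberg MA cA MB cB pA pB ↔ pA = 0 ∧ pB = pHat MB cB 0 := by
  have hst : cB * MA < MB := h.trans (mul_lt_of_lt_one_left hMB hcA.2)
  have hlt := offsetValue_zero_lt_uA_zero (cA := cA) hMA hcB hst
  have hresp (b : ℝ) : IsBestResponse MA cA MB cB 0 b ↔ b = pHat MB cB 0 := by
    simp only [isBestResponse_iff_of_strong hcB le_rfl (show cA * 0 < MA by simpa)
      (by simpa using hst), hlt.le, hlt.not_ge, and_false, and_true, false_or]
  rw [← hresp]
  refine isStackelberg_iff_of_forall_lt hcA.1 ⟨le_rfl, (div_pos hMA hcA.1).le⟩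
    (fun q hq0 hq hne => ?_) pA pB
  have hq_st : cB * (MA - cA * q) < MB - cB * q := by
    refine lt_of_mul_lt_mul_left ?_ hcA.1.le
    linarith [mul_le_of_le_one_left (mul_nonneg hcB.1.le (sub_nonneg.2 hq)) hcA.2.le]
  rw [((hresp _).2 rfl).securedValue_eq,
    uA_pHat hcB (by simpa using hMA.le) (by simpa) (by simpa using hst.le)]
  refine (securedValue_le_offsetValue hcB hq0 hq hq_st).trans_lt ?_
  rw [offsetValue_lt_iff hcB (mul_lt_of_strong hcB.1.le hq hq_st) (by simpa)]
  exact mul_pos_of_neg_of_neg (by linarith [hq0.lt_of_ne' hne]) (sub_neg.2 h)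

end equilibria

end Lotto

end

theorem mainTheorem4 (MA MB cA cB : ℝ) (hMA : 0 < MA) (hMB : 0 < MB)
    (hcA : cA ∈ Set.Ioo (0 : ℝ) 1) (hcB : cB ∈ Set.Ioo (0 : ℝ) 1) :
    -- without a response of B, the unique optimal investment of A has pre-allocation `pBar`
    (MB / cB ≤ MA / cA → ∀ P R : ℝ, Lotto.IsOptimalInvestment MA cA MB P R ↔
      P = Lotto.pBar MA cA ∧ R = MA - cA * Lotto.pBar MA cA) ∧
    -- 1. B is weak
    (MB / cB ≤ MA → ∀ pA pB : ℝ, Lotto.IsStackelberg MA cA MB cB pA pB ↔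
      pA = Lotto.pBar MA cA ∧ pB = 0) ∧
    -- 2. the middle range
    (MA < MB / cB → MB / cB < MA / cA →
      ∃ pd : ℝ, (∀ q : ℝ, Lotto.IsIndifference MA cA MB cB q ↔ q = pd) ∧
        (pd < Lotto.pBar MA cA → ∀ pA pB : ℝ, Lotto.IsStackelberg MA cA MB cB pA pB ↔
          pA = Lotto.pBar MA cA ∧ pB = 0) ∧
        (Lotto.pBar MA cA ≤ pd → ∀ pA pB : ℝ, Lotto.IsStackelberg MA cA MB cB pA pB ↔
          pA = pd ∧ (pB = 0 ∨ pB = Lotto.pHat MB cB pd))) ∧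
    -- 2'. the upper end of the middle range
    (MB / cB = MA / cA → ∀ pd : ℝ, Lotto.IsIndifference MA cA MB cB pd →
      (∀ q : ℝ, Lotto.IsIndifference MA cA MB cB q → q = pd) ∧
      Lotto.pBar MA cA ≤ pd ∧
      Lotto.IsStackelberg MA cA MB cB pd 0 ∧
      Lotto.IsStackelberg MA cA MB cB pd (Lotto.pHat MB cB pd)) ∧
    -- 3. B is strong
    (MA / cA < MB / cB → ∀ pA pB : ℝ, Lotto.IsStackelberg MA cA MB cB pA pB ↔
      pA = 0 ∧ pB = Lotto.pHat MB cB 0) := by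
  refine ⟨fun h => ?_, fun h => ?_, fun h₁ h₂ => ?_, fun h pd hpd => ?_, fun h => ?_⟩
  · rw [div_le_div_iff₀ hcB.1 hcA.1, mul_comm MB, mul_comm MA] at h
    exact Lotto.isOptimalInvestment_iff hMA hMB hcA
      (h.trans_lt (mul_lt_of_lt_one_left hMA hcB.2))
  · exact Lotto.isStackelberg_iff_of_weak hMA hMB hcA hcB ((div_le_iff₀' hcB.1).1 h)
  · rw [lt_div_iff₀' hcB.1] at h₁
    rw [div_lt_div_iff₀ hcB.1 hcA.1, mul_comm MB, mul_comm MA] at h₂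
    obtain ⟨pd, hpd⟩ := Lotto.exists_isIndifference hMA hcA hcB h₁ h₂
    exact ⟨pd, fun q => ⟨fun hq => hq.eq hMA hcA.1 hcB h₁ h₂.le hpd, fun hq => hq ▸ hpd⟩,
      Lotto.isStackelberg_iff_of_isIndifference_lt_pBar hMA hcA hcB h₁ h₂.le hpd,
      Lotto.isStackelberg_iff_of_pBar_le_isIndifference hMA hMB hcA hcB h₂ hpd⟩
  · rw [div_eq_div_iff hcB.1.ne' hcA.1.ne', mul_comm MB, mul_comm MA] at h
    have h₁ : cB * MA < MB := h ▸ mul_lt_of_lt_one_left hMB hcA.2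
    exact ⟨fun q hq => hq.eq hMA hcA.1 hcB h₁ h.le hpd, hpd.pBar_le_of_mul_eq hMA hMB hcA hcB h,
      hpd.isStackelberg_of_mul_eq hMA hMB hcA hcB h (Or.inl rfl),
      hpd.isStackelberg_of_mul_eq hMA hMB hcA hcB h (Or.inr rfl)⟩
  · rw [div_lt_div_iff₀ hcA.1 hcB.1, mul_comm MB, mul_comm MA] at h
    exact Lotto.isStackelberg_iff_of_strong hMA hMB hcA hcB h
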